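/- Let $\mathfrak L$ be a finite set. **Multi-indices.** Let $\mathbb R[\mathfrak L\times\mathbb N_0]$ be the polynomial algebra in the variables $\mathsf z_{(\mathfrak l,k)}$, and let $D=\sum_{(\mathfrak l,k)}(k+1)\,\mathsf z_{(\mathfrak l,k+1)}\partial_{\mathsf z_{(\mathfrak l,k)}}$. Let $\mathcal T$ be the set of finitely supported $\beta:\mathfrak L\times\mathbb N_0\to\mathbb N_0$ with $\sum_{(\mathfrak l,k)}(1-k)\beta(\mathfrak l,k)=1$, and let $T=\mathrm{span}\{\mathsf z^\beta:\beta\in\mathcal T\}$, a pre-Lie algebra under $(\pi,\pi')\mapsto \pi\, D\pi'$. **Trees.** Let $\mathcal H$ be the set of (non-planar) rooted trees with nodes decorated by $\mathfrak L$; every tree is written $\tau=\Xi_{\mathfrak l}\prod_{j=1}^k\mathcal I(\tau_j)$, with root decoration $\mathfrak l$ and multiset of subtrees $\tau_1,\dots,\tau_k$. Let $\mathcal B=\mathrm{span}\,\mathcal H$ with the grafting pre-Lie product $$\tau'\curvearrowright\tau=\Xi_{\mathfrak l}\,\mathcal I(\tau')\prod_{j}\mathcal I(\tau_j)+\Xi_{\mathfrak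 l}\sum_{j}\mathcal I(\tau'\curvearrowright\tau_j)\prod_{i\ne j}\mathcal I(\tau_i).$$ The symmetry factor is $\sigma(\tau)=I!\prod_j\sigma(\tau_j)$ with $I=\sum_j e_{\tau_j}$. Let $\Psi:\mathcal B\to T$ be the linear map with $\Psi[\tau]=\prod_{(\mathfrak l,k)}(k!)^{\beta(\mathfrak l,k)}\,\mathsf z^{\beta}$, where $\beta(\mathfrak l,k)$ is the number of nodes of $\tau$ with decoration $\mathfrak l$ and $k$ children. **Enveloping algebras and pairings.** For a pre-Lie algebra $(L,\triangleright)$ with basis $(a_i)_{i\in\mathcal I}$, let $\mathrm U(L,\triangleright)$ be the universal enveloping algebra of the Lie algebra with bracket $a\triangleright a'-a'\triangleright a$. Let $\star:\mathrm U(L,\triangleright)\times L\to \mathrm U(L,\triangleright)$ be the bilinear map determined by $1\star a=a$ and $(bU)\star a=b(U\star a)-U\star(b\triangleright a)$ for $a,b\in L$. For a multi-index $I=e_{i_1}+\dots+e_{i_k}$ let $A_I=\frac1{I!}\,(\cdots(1\star a_{i_1})\cdots)\star a_{i_k}$; these elements form a basis (the Guin–Oudom basis) of $\mathrm U(L,\triangleright)$.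 Let $\mathbb R[\mathcal T]$ and $\mathbb R[\mathcal H]$ be the polynomial algebras generated by $\mathcal T$ and by $\mathcal H$. Pair $\mathrm U(T,D)$ with $\mathbb R[\mathcal T]$ by $\langle A_I,z^J\rangle=\delta_{I}^{J}$, and $\mathrm U(\mathcal B,\curvearrowright)$ with $\mathbb R[\mathcal H]$ by $\langle A_I,\prod_\tau\tau^{J(\tau)}\rangle_\sigma=\delta_{I}^{J}\prod_\tau\sigma(\tau)^{I(\tau)}$, which extends $\langle\tau',\tau\rangle_\sigma=\delta_{\tau}^{\tau'}\sigma(\tau)$. **Statement.** 1. $\Psi:(\mathcal B,\curvearrowright)\to(T,D)$ is a pre-Lie morphism: $\Psi[x\curvearrowright y]=\Psi[x]\,D\Psi[y]$ for all $x,y\in\mathcal B$. Hence $\Psi$ extends to an algebra morphism $\Psi:\mathrm U(\mathcal B,\curvearrowright)\to\mathrm U(T,D)$. 2. There is a Hopf algebra structure on the algebra $\mathbb R[\mathcal T]$ whose coproduct $\Delta_D$ is the transpose of the product of $\mathrm U(T,D)$, i.e. $\langle U\otimes V,\Delta_D p\rangle=\langle UV,p\rangle$. The algebra $\mathbb R[\mathcal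 H]$ is a Hopf algebra under the Connes–Kreimer coproduct, i.e. the algebra morphism $\Delta_{CK}$ with $\Delta_{CK}\tau=\tau\otimes1+(\mathrm{id}\otimes B_+^{\mathfrak l})\big(\Delta_{CK}\tau_1\cdots\Delta_{CK}\tau_k\big)$ for $\tau=\Xi_{\mathfrak l}\prod_j\mathcal I(\tau_j)$, where the linear map $B_+^{\mathfrak l}$ sends each monomial $\tau_1\cdots\tau_k$ to $\Xi_{\mathfrak l}\prod_j\mathcal I(\tau_j)$. The transpose $\Psi^\dagger:\mathbb R[\mathcal T]\to\mathbb R[\mathcal H]$, defined by $\langle U,\Psi^\dagger p\rangle_\sigma=\langle\Psi U,p\rangle$ for all $U\in\mathrm U(\mathcal B,\curvearrowright)$ and $p\in\mathbb R[\mathcal T]$, exists and is a Hopf algebra morphism from $(\mathbb R[\mathcal T],\Delta_D)$ to the Connes–Kreimer Hopf algebra $(\mathbb R[\mathcal H],\Delta_{CK})$: it is an algebra morphism compatible with coproducts, counits and antipodes. -/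

import Mathlib

open scoped TensorProduct

noncomputable section

section GuinOudom

variable {L : Type*} [LeftPreLieRing L] [LeftPreLieAlgebra ℝ L]

attribute [local instance 100] LieRing.ofAssociativeRing

/-- Universal enveloping algebra (over `ℝ`) of the Lie algebra `[a, b] = a * b - b * a` underlying
a left pre-Lie algebra. -/
abbrev Env (L : Type*) [LeftPreLieRing L] [LeftPreLieAlgebra ℝ L] : Type _ :=
  UniversalEnvelopingAlgebra ℝ L

/-- The canonical map `L → U(L)`. -/
abbrev Env.of : L →ₗ⁅ℝ⁆ Env L := UniversalEnvelopingAlgebra.ι ℝ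

/-- The Lie action of `L` on linear maps `f : L → U(L)` by `(b • f)(a) = b f(a) - f(b ▷ a)`. -/
def goRep : L →ₗ⁅ℝ⁆ Module.End ℝ (L →ₗ[ℝ] Env L) where
  toFun b :=
    { toFun := fun f => (LinearMap.mulLeft ℝ (Env.of b)) ∘ₗ f - f ∘ₗ LinearMap.mulLeft ℝ b
      map_add' := fun f g => by
        ext a; simp [mul_add]; abel
      map_smul' := fun r f => by
        ext a; simp [smul_sub] }
  map_add' b c := by
    ext f a; simp [add_mul]; abel
  map_smul' r b := by
    ext f a; simp [smul_sub, smul_mul_assoc]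
  map_lie' {b c} := by
    ext f a
    have h : associator b c a = associator c b a := LeftPreLieRing.assoc_symm b c a
    simp only [associator_apply] at h
    have h2 : f ((b * c - c * b) * a) = f (b * (c * a)) - f (c * (b * a)) := by
      rw [← map_sub]; congr 1
      rw [sub_mul]
      have := sub_eq_sub_iff_add_eq_add.mp h
      rw [sub_eq_sub_iff_add_eq_add, this]; abel
    have h3 : (Env.of (b * c - c * b) : Env L) = Env.of b * Env.of c - Env.of c * Env.of b := by
      rw [← Ring.lie_def, LieHom.map_lie, Ring.lie_def]
    simp only [Ring.lie_def, LinearMap.coe_mk, AddHom.coe_mk, LinearMap.sub_apply,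
      LinearMap.comp_apply, LinearMap.mulLeft_apply, Module.End.mul_apply]
    rw [h2, h3]
    simp only [sub_mul, mul_sub, mul_assoc]
    abel

/-- The right operation `u ⋆ a` of `L` on its enveloping algebra, characterized by `1 ⋆ a = a` and
`(b u) ⋆ a = b (u ⋆ a) - u ⋆ (b ▷ a)` (`goStar_one` and `goStar_of_mul` below). -/
def goStar (u : Env L) : L →ₗ[ℝ] Env L :=
  UniversalEnvelopingAlgebra.lift ℝ goRep u (Env.of : L →ₗ⁅ℝ⁆ Env L)

theorem goStar_one (a : L) : goStar 1 a = Env.of a := by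
  simp [goStar]

theorem goStar_of_mul (b : L) (u : Env L) (a : L) :
    goStar (Env.of b * u) a = Env.of b * goStar u a - goStar u (b * a) := by
  unfold goStar
  rw [map_mul, UniversalEnvelopingAlgebra.lift_ι_apply]
  rfl

theorem goStar_add (u v : Env L) (a : L) : goStar (u + v) a = goStar u a + goStar v a := by
  simp [goStar]

theorem goStar_smul (r : ℝ) (u : Env L) (a : L) : goStar (r • u) a = r • goStar u a := by
  simp [goStar]

theorem Env.induction {p : Env L → Prop} (h1 : p 1) (hadd : ∀ u v, p u → p v → p (u + v))
    (hsmul : ∀ (r : ℝ) u, p u → p (r • u)) (hmul : ∀ b u, p u → p (Env.of b * u)) (u : Env L) :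
    p u := by
  let S : Subalgebra ℝ (Env L) :=
    { carrier := {x | ∀ u, p u → p (x * u)}
      mul_mem' := fun {x y} hx hy u hu => by rw [mul_assoc]; exact hx _ (hy _ hu)
      add_mem' := fun {x y} hx hy u hu => by rw [add_mul]; exact hadd _ _ (hx _ hu) (hy _ hu)
      algebraMap_mem' := fun r u hu => by rw [← Algebra.smul_def]; exact hsmul _ _ hu }
  let j : L →ₗ⁅ℝ⁆ S :=
    { toFun := fun b => ⟨Env.of b, fun u hu => hmul b u hu⟩
      map_add' := fun b c => by ext; simp
      map_smul' := fun r b => by ext; simp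
      map_lie' := fun {b c} => by
        ext
        simp only [LieHom.map_lie]
        rfl }
  have hid : S.val.comp (UniversalEnvelopingAlgebra.lift ℝ j) = AlgHom.id ℝ (Env L) := by
    ext b
    simp only [AlgHom.coe_toLieHom, LieHom.coe_comp, Function.comp_apply, AlgHom.coe_comp,
      UniversalEnvelopingAlgebra.lift_ι_apply, AlgHom.coe_id, id]
    rfl
  have hu : u ∈ S := by
    have := DFunLike.congr_fun hid u
    simp only [AlgHom.coe_comp, Function.comp_apply, AlgHom.coe_id, id] at this
    rw [← this]
    exact Subtype.property _
  simpa using hu 1 h1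

theorem goStar_comm (u : Env L) (a a' : L) :
    goStar (goStar u a) a' = goStar (goStar u a') a := by
  induction u using Env.induction generalizing a a' with
  | h1 =>
    rw [goStar_one, goStar_one, ← mul_one (Env.of a), ← mul_one (Env.of a'), goStar_of_mul,
      goStar_of_mul, goStar_one, goStar_one, goStar_one, goStar_one, sub_eq_sub_iff_sub_eq_sub,
      ← map_sub, ← Ring.lie_def a a', LieHom.map_lie, Ring.lie_def]
  | hadd u v hu hv => simp only [goStar_add]; rw [hu, hv]
  | hsmul r u hu => simp only [goStar_smul]; rw [hu]
  | hmul b u hu =>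
    have hsub : ∀ (v w : Env L) (c : L), goStar (v - w) c = goStar v c - goStar w c := by
      intro v w c; simp [goStar]
    simp only [goStar_of_mul, hsub]
    rw [hu a a', hu a (b * a'), hu (b * a) a']
    abel

instance goStar_rightCommutative {ι : Type*} (b : ι → L) :
    RightCommutative fun (u : Env L) (i : ι) => goStar u (b i) :=
  ⟨fun u i j => goStar_comm u (b i) (b j)⟩

variable {ι : Type*}

/-- `1 ⋆ a_{i_1} ⋆ ⋯ ⋆ a_{i_k}` for the multiset `{i_1, …, i_k}`. -/
def goProd (b : ι → L) (s : Multiset ι) : Env L :=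
  s.foldl (fun u i => goStar u (b i)) 1

/-- The Guin–Oudom element `A_I = (1 / I!) a_{i_1} ⋆ ⋯ ⋆ a_{i_k}`, where `I = e_{i_1} + ⋯ + e_{i_k}`. -/
def goElem (b : ι → L) (I : ι →₀ ℕ) : Env L :=
  ((I.prod fun _ n => (n.factorial : ℝ))⁻¹) • goProd b (Finsupp.toMultiset I)

theorem goProd_cons (b : ι → L) (i : ι) (s : Multiset ι) :
    goProd b (i ::ₘ s) = goStar (goProd b s) (b i) := by
  have : ∀ (s : Multiset ι) (u : Env L) (a : L), s.foldl (fun u i => goStar u (b i)) (goStar u a) =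
      goStar (s.foldl (fun u i => goStar u (b i)) u) a := by
    intro s
    induction s using Multiset.induction with
    | empty => intro u a; simp
    | cons j s ih => intro u a; simp only [Multiset.foldl_cons]; rw [goStar_comm, ih]
  unfold goProd
  rw [Multiset.foldl_cons, this]

/-- The Lie action of `L` on the symmetric algebra by `a • s = a s + (a ▷ s)`. -/
def symRep (b : Module.Basis ι ℝ L) : L →ₗ⁅ℝ⁆ Module.End ℝ (MvPolynomial ι ℝ) where
  toFun a := LinearMap.mulLeft ℝ (b.constr ℝ (MvPolynomial.X (R := ℝ)) a) +
    (MvPolynomial.mkDerivation ℝ fun i =>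
      b.constr ℝ (MvPolynomial.X (R := ℝ)) (a * b i)).toLinearMap
  map_add' a c := by
    have h : (MvPolynomial.mkDerivation ℝ fun i =>
          b.constr ℝ (MvPolynomial.X (R := ℝ)) ((a + c) * b i)) =
        (MvPolynomial.mkDerivation ℝ fun i => b.constr ℝ (MvPolynomial.X (R := ℝ)) (a * b i)) +
        (MvPolynomial.mkDerivation ℝ fun i => b.constr ℝ (MvPolynomial.X (R := ℝ)) (c * b i)) := by
      apply MvPolynomial.derivation_ext
      intro i
      rw [Derivation.add_apply]
      simp only [MvPolynomial.mkDerivation_X, add_mul, map_add]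
    rw [h]
    refine LinearMap.ext fun p => ?_
    simp only [map_add, LinearMap.add_apply, LinearMap.mulLeft_apply, add_mul,
      Derivation.coe_add_linearMap]
    abel
  map_smul' r a := by
    have h : (MvPolynomial.mkDerivation ℝ fun i =>
          b.constr ℝ (MvPolynomial.X (R := ℝ)) ((r • a) * b i)) =
        r • (MvPolynomial.mkDerivation ℝ fun i =>
          b.constr ℝ (MvPolynomial.X (R := ℝ)) (a * b i)) := by
      apply MvPolynomial.derivation_ext
      intro i
      rw [Derivation.smul_apply]
      simp only [MvPolynomial.mkDerivation_X, smul_mul_assoc, map_smul]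
    rw [h]
    refine LinearMap.ext fun p => ?_
    simp
  map_lie' {a c} := by
    set j : L →ₗ[ℝ] MvPolynomial ι ℝ := b.constr ℝ (MvPolynomial.X (R := ℝ)) with hj
    let D : L → Derivation ℝ (MvPolynomial ι ℝ) (MvPolynomial ι ℝ) := fun a =>
      MvPolynomial.mkDerivation ℝ fun i => j (a * b i)
    have hD : ∀ a x, D a (j x) = j (a * x) := by
      intro a x
      have : (D a).toLinearMap ∘ₗ j = j ∘ₗ LinearMap.mulLeft ℝ a := by
        refine b.ext fun i => ?_
        simp [D, hj, Module.Basis.constr_basis]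
      exact LinearMap.congr_fun this x
    have h : D ⁅a, c⁆ = ⁅D a, D c⁆ := by
      apply MvPolynomial.derivation_ext
      intro i
      have hX : (MvPolynomial.X i : MvPolynomial ι ℝ) = j (b i) := by
        rw [hj, Module.Basis.constr_basis]
      rw [Derivation.commutator_apply, hX, hD, hD, hD, hD, hD, ← map_sub]
      congr 1
      have h := LeftPreLieRing.assoc_symm a c (b i)
      simp only [associator_apply] at h
      rw [Ring.lie_def, sub_mul]
      have := sub_eq_sub_iff_add_eq_add.mp h
      rw [sub_eq_sub_iff_add_eq_add, this]; abel
    refine LinearMap.ext fun p => ?_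
    change j ⁅a, c⁆ * p + D ⁅a, c⁆ p = _
    rw [h, Derivation.commutator_apply, Ring.lie_def, Ring.lie_def, map_sub]
    change _ = (j a * (j c * p + D c p) + D a (j c * p + D c p)) -
      (j c * (j a * p + D a p) + D c (j a * p + D a p))
    simp only [map_add, Derivation.leibniz, hD, smul_eq_mul]
    ring

/-- `u ↦ u • 1`, with values in the symmetric algebra. -/
def symMap (b : Module.Basis ι ℝ L) : Env L →ₗ[ℝ] MvPolynomial ι ℝ :=
  (LinearMap.applyₗ 1) ∘ₗ (UniversalEnvelopingAlgebra.lift ℝ (symRep b)).toLinearMap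

theorem symMap_of_mul (b : Module.Basis ι ℝ L) (a : L) (u : Env L) :
    symMap b (Env.of a * u) = symRep b a (symMap b u) := by
  simp only [symMap, LinearMap.comp_apply, AlgHom.toLinearMap_apply, map_mul,
    UniversalEnvelopingAlgebra.lift_ι_apply]
  rfl

theorem symMap_goStar (b : Module.Basis ι ℝ L) (u : Env L) (a : L) :
    symMap b (goStar u a) = symMap b u * b.constr ℝ (MvPolynomial.X (R := ℝ)) a := by
  set j : L →ₗ[ℝ] MvPolynomial ι ℝ := b.constr ℝ (MvPolynomial.X (R := ℝ)) with hj
  induction u using Env.induction generalizing a with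
  | h1 =>
    rw [goStar_one, ← mul_one (Env.of a), symMap_of_mul]
    have : symMap b 1 = 1 := by simp [symMap]
    rw [this]
    simp [symRep, hj]
  | hadd u v hu hv => rw [goStar_add, map_add, map_add, add_mul, hu, hv]
  | hsmul r u hu => rw [goStar_smul, map_smul, map_smul, smul_mul_assoc, hu]
  | hmul c u hu =>
    rw [goStar_of_mul, map_sub, symMap_of_mul, symMap_of_mul, hu, hu]
    let D : Derivation ℝ (MvPolynomial ι ℝ) (MvPolynomial ι ℝ) :=
      MvPolynomial.mkDerivation ℝ fun i => j (c * b i)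
    have hD : ∀ x, D (j x) = j (c * x) := by
      intro x
      have : D.toLinearMap ∘ₗ j = j ∘ₗ LinearMap.mulLeft ℝ c := by
        refine b.ext fun i => ?_
        simp [D, hj, Module.Basis.constr_basis]
      exact LinearMap.congr_fun this x
    change j c * (symMap b u * j a) + D (symMap b u * j a) - _ =
      (j c * symMap b u + D (symMap b u)) * j a
    rw [Derivation.leibniz, hD]
    simp only [smul_eq_mul]
    ring

theorem symMap_goElem (b : Module.Basis ι ℝ L) (I : ι →₀ ℕ) :
    symMap b (goElem b I) =
      ((I.prod fun _ n => (n.factorial : ℝ))⁻¹) • MvPolynomial.monomial I 1 := by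
  have h : ∀ s : Multiset ι, symMap b (goProd b s) = (s.map (MvPolynomial.X (R := ℝ))).prod := by
    intro s
    induction s using Multiset.induction with
    | empty => simp [goProd, symMap]
    | cons i s ih =>
      rw [goProd_cons, symMap_goStar, ih, Module.Basis.constr_basis, Multiset.map_cons,
        Multiset.prod_cons, mul_comm]
  rw [goElem, map_smul, h, MvPolynomial.monomial_eq, Finsupp.toMultiset_map,
    Finsupp.prod_toMultiset, Finsupp.prod_mapDomain_index (by simp) (by simp [pow_add])]
  simp

theorem goElem_linearIndependent (b : Module.Basis ι ℝ L) :
    LinearIndependent ℝ (goElem b) := by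
  apply LinearIndependent.of_comp (symMap b)
  have h : (symMap b ∘ goElem b) = fun I => (Units.mk0 ((I.prod fun _ n => (n.factorial : ℝ))⁻¹)
      (inv_ne_zero (Finset.prod_ne_zero_iff.mpr fun i _ => by positivity))) •
        (MvPolynomial.basisMonomials ι ℝ) I := by
    funext I
    simp [symMap_goElem, Units.smul_def]
  rw [h]
  exact (MvPolynomial.basisMonomials ι ℝ).linearIndependent.units_smul _

theorem goElem_span (b : Module.Basis ι ℝ L) :
    ⊤ ≤ Submodule.span ℝ (Set.range (goElem b)) := by
  set S := Submodule.span ℝ (Set.range (goElem b)) with hS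
  have hprod : ∀ s : Multiset ι, goProd b s ∈ S := by
    classical
    intro s
    have hne : ((Multiset.toFinsupp s).prod fun _ n => (n.factorial : ℝ)) ≠ 0 :=
      Finset.prod_ne_zero_iff.mpr fun i _ => by positivity
    have : goProd b s = ((Multiset.toFinsupp s).prod fun _ n => (n.factorial : ℝ)) •
        goElem b (Multiset.toFinsupp s) := by
      rw [goElem, smul_smul, mul_inv_cancel₀ hne, one_smul, Multiset.toFinsupp_toMultiset]
    rw [this]
    exact S.smul_mem _ (Submodule.subset_span ⟨_, rfl⟩)
  have hstar : ∀ u ∈ S, ∀ a, goStar u a ∈ S := by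
    intro u hu a
    rw [← b.linearCombination_repr a, Finsupp.linearCombination_apply, Finsupp.sum, map_sum]
    refine S.sum_mem fun i _ => ?_
    rw [map_smul]
    refine S.smul_mem _ ?_
    induction hu using Submodule.span_induction with
    | mem x hx =>
      obtain ⟨I, rfl⟩ := hx
      rw [goElem, goStar_smul, ← goProd_cons]
      exact S.smul_mem _ (hprod _)
    | zero => simp [goStar]
    | add x y _ _ hx hy => rw [goStar_add]; exact S.add_mem hx hy
    | smul r x _ hx => rw [goStar_smul]; exact S.smul_mem _ hx
  have hmulp : ∀ s : Multiset ι, ∀ a, Env.of a * goProd b s ∈ S := by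
    intro s
    induction s using Multiset.induction with
    | empty =>
      intro a
      have : Env.of a * goProd b 0 = goStar (goProd b 0) a := by simp [goProd, goStar_one]
      rw [this]
      exact hstar _ (hprod 0) a
    | cons i s ih =>
      intro a
      have : Env.of a * goProd b (i ::ₘ s) =
          goStar (Env.of a * goProd b s) (b i) + goStar (goProd b s) (a * b i) := by
        rw [goProd_cons, goStar_of_mul]; abel
      rw [this]
      exact S.add_mem (hstar _ (ih a) _) (hstar _ (hprod s) _)
  rintro u -
  induction u using Env.induction with
  | h1 => simpa [goProd] using hprod 0
  | hadd u v hu hv => exact S.add_mem hu hv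
  | hsmul r u hu => exact S.smul_mem _ hu
  | hmul a u hu =>
    induction hu using Submodule.span_induction with
    | mem x hx =>
      obtain ⟨I, rfl⟩ := hx
      rw [goElem, mul_smul_comm]
      exact S.smul_mem _ (hmulp _ _)
    | zero => simp
    | add x y _ _ hx hy => rw [mul_add]; exact S.add_mem hx hy
    | smul r x _ hx => rw [mul_smul_comm]; exact S.smul_mem _ hx

/-- The Guin–Oudom basis `(A_I)` of `U(L)` over a basis of `L`, indexed by multi-indices. -/
def goBasis (b : Module.Basis ι ℝ L) : Module.Basis (ι →₀ ℕ) ℝ (Env L) :=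
  Module.Basis.mk (goElem_linearIndependent b) (goElem_span b)

theorem goBasis_apply (b : Module.Basis ι ℝ L) (I : ι →₀ ℕ) : goBasis b I = goElem b I := by
  simp [goBasis]

/-- The pairing of `U(L)` with the polynomial algebra given by
`⟨A_I, a^J⟩ = δ_{I J} ∏ i, w(i) ^ I(i)`. -/
def goPairing (b : Module.Basis ι ℝ L) (w : ι → ℝ) :
    Env L →ₗ[ℝ] MvPolynomial ι ℝ →ₗ[ℝ] ℝ :=
  (goBasis b).constr ℝ fun I => (I.prod fun i n => w i ^ n) • MvPolynomial.lcoeff ℝ I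

end GuinOudom

section MultiIndices

variable (𝔏 : Type*)

/-- The number `[β] = ∑_{(l,k)} (1 - k) β(l,k)` attached to a multi-index `β` over `𝔏 × ℕ`. -/
def bracket {𝔏 : Type*} (β : 𝔏 × ℕ →₀ ℕ) : ℤ := β.sum fun x n => (1 - (x.2 : ℤ)) * n

/-- The populated multi-indices `𝒯`, i.e. those with `[β] = 1`. -/
abbrev Populated : Type _ := {β : 𝔏 × ℕ →₀ ℕ // bracket β = 1}

/-- The derivation `D = ∑_{(l,k)} (k + 1) z_{(l,k+1)} ∂_{z_{(l,k)}}` of `ℝ[𝔏 × ℕ]`. -/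
def shiftD : Derivation ℝ (MvPolynomial (𝔏 × ℕ) ℝ) (MvPolynomial (𝔏 × ℕ) ℝ) :=
  MvPolynomial.mkDerivation ℝ fun x => ((x.2 : ℝ) + 1) • MvPolynomial.X (x.1, x.2 + 1)

/-- The space `T` of polynomials all of whose monomials `z^β` satisfy `[β] = 1`. -/
abbrev MultiIndexSpace : Type _ :=
  MvPolynomial.restrictSupport ℝ {β : 𝔏 × ℕ →₀ ℕ | bracket β = 1}

variable {𝔏}

theorem bracket_add (β γ : 𝔏 × ℕ →₀ ℕ) : bracket (β + γ) = bracket β + bracket γ := by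
  classical
  unfold bracket
  rw [Finsupp.sum_add_index'] <;> intros <;> push_cast <;> ring

theorem bracket_single (x : 𝔏 × ℕ) (n : ℕ) :
    bracket (Finsupp.single x n) = (1 - (x.2 : ℤ)) * n := by
  simp [bracket]

theorem mul_shiftD_mem {p q : MvPolynomial (𝔏 × ℕ) ℝ}
    (hp : p ∈ MvPolynomial.restrictSupport ℝ {β : 𝔏 × ℕ →₀ ℕ | bracket β = 1})
    (hq : q ∈ MvPolynomial.restrictSupport ℝ {β : 𝔏 × ℕ →₀ ℕ | bracket β = 1}) :
    p * shiftD 𝔏 q ∈ MvPolynomial.restrictSupport ℝ {β : 𝔏 × ℕ →₀ ℕ | bracket β = 1} := by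
  set S := MvPolynomial.restrictSupport ℝ {β : 𝔏 × ℕ →₀ ℕ | bracket β = 1} with hS
  have key : ∀ β γ : 𝔏 × ℕ →₀ ℕ, bracket β = 1 → bracket γ = 1 →
      MvPolynomial.monomial β (1 : ℝ) * shiftD 𝔏 (MvPolynomial.monomial γ 1) ∈ S := by
    intro β γ hβ hγ
    rw [shiftD, MvPolynomial.mkDerivation_monomial, Finsupp.sum, Finset.smul_sum, Finset.mul_sum]
    refine S.sum_mem fun x hx => ?_
    have hle : Finsupp.single x 1 ≤ γ := by
      rw [Finsupp.single_le_iff]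
      exact Nat.one_le_iff_ne_zero.mpr (Finsupp.mem_support_iff.mp hx)
    obtain ⟨δ, rfl⟩ := exists_add_of_le hle
    rw [add_tsub_cancel_left, one_smul, smul_eq_mul, MvPolynomial.X, mul_smul_comm, mul_smul_comm,
      MvPolynomial.monomial_mul, MvPolynomial.monomial_mul]
    refine S.smul_mem _ ?_
    rw [hS, MvPolynomial.monomial_mem_restrictSupport]
    left
    simp only [bracket_add, bracket_single] at hγ
    simp only [Set.mem_ofPred_eq, bracket_add, bracket_single]
    push_cast at hγ ⊢
    linarith
  rw [hS, MvPolynomial.restrictSupport_eq_span] at hp hq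
  induction hp using Submodule.span_induction with
  | mem x hx =>
    obtain ⟨β, hβ, rfl⟩ := hx
    induction hq using Submodule.span_induction with
    | mem y hy =>
      obtain ⟨γ, hγ, rfl⟩ := hy
      exact key β γ hβ hγ
    | zero => simp
    | add y z _ _ hy hz => rw [map_add, mul_add]; exact S.add_mem hy hz
    | smul r y _ hy => rw [Derivation.map_smul, mul_smul_comm]; exact S.smul_mem _ hy
  | zero => simp
  | add y z _ _ hy hz => rw [add_mul]; exact S.add_mem hy hz
  | smul r y _ hy => rw [smul_mul_assoc]; exact S.smul_mem _ hy

/-- The pre-Lie product `p D q` on `T`: the product of `p` and `D q`. -/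
instance : Mul (MultiIndexSpace 𝔏) where
  mul p q := ⟨p.1 * shiftD 𝔏 q.1, mul_shiftD_mem p.2 q.2⟩

theorem MultiIndexSpace.coe_mul (p q : MultiIndexSpace 𝔏) :
    ((p * q : MultiIndexSpace 𝔏) : MvPolynomial (𝔏 × ℕ) ℝ) = p.1 * shiftD 𝔏 q.1 := rfl

instance : LeftPreLieRing (MultiIndexSpace 𝔏) where
  left_distrib p q r := Subtype.ext <| by
    simp [MultiIndexSpace.coe_mul, mul_add]
  right_distrib p q r := Subtype.ext <| by
    simp [MultiIndexSpace.coe_mul, add_mul]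
  zero_mul p := Subtype.ext <| by simp [MultiIndexSpace.coe_mul]
  mul_zero p := Subtype.ext <| by simp [MultiIndexSpace.coe_mul]
  assoc_symm' p q r := by
    refine Subtype.ext ?_
    change p.1 * shiftD 𝔏 q.1 * shiftD 𝔏 r.1 - p.1 * shiftD 𝔏 (q.1 * shiftD 𝔏 r.1) =
      q.1 * shiftD 𝔏 p.1 * shiftD 𝔏 r.1 - q.1 * shiftD 𝔏 (p.1 * shiftD 𝔏 r.1)
    simp only [Derivation.leibniz, smul_eq_mul]
    ring

instance : LeftPreLieAlgebra ℝ (MultiIndexSpace 𝔏) where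
  smul_assoc r p q := Subtype.ext <| by
    simp [MultiIndexSpace.coe_mul]
  smul_comm r p q := Subtype.ext <| by
    simp [MultiIndexSpace.coe_mul]

/-- The monomial basis `(z^β)` of `T`. -/
def zBasis (𝔏 : Type*) : Module.Basis (Populated 𝔏) ℝ (MultiIndexSpace 𝔏) :=
  MvPolynomial.basisRestrictSupport ℝ {β : 𝔏 × ℕ →₀ ℕ | bracket β = 1}

theorem zBasis_apply (β : Populated 𝔏) :
    (zBasis 𝔏 β : MvPolynomial (𝔏 × ℕ) ℝ) = MvPolynomial.monomial β.1 1 := by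
  have hβ : MvPolynomial.monomial β.1 (1 : ℝ) ∈
      MvPolynomial.restrictSupport ℝ {β : 𝔏 × ℕ →₀ ℕ | bracket β = 1} := by
    rw [MvPolynomial.monomial_mem_restrictSupport]
    exact Or.inl β.2
  have : zBasis 𝔏 β = ⟨MvPolynomial.monomial β.1 1, hβ⟩ := by
    rw [Module.Basis.apply_eq_iff]
    classical
    ext γ
    change MvPolynomial.coeff γ.1 (MvPolynomial.monomial β.1 (1 : ℝ)) = _
    rw [MvPolynomial.coeff_monomial, Finsupp.single_apply]
    simp only [Subtype.ext_iff]
  rw [this]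

end MultiIndices

section Trees

/-- Planar rooted trees with nodes decorated by `𝔏`: a root and the list of its subtrees. -/
inductive PlanarTree (𝔏 : Type*) : Type _
  | node : 𝔏 → List (PlanarTree 𝔏) → PlanarTree 𝔏

/-- One step of the identification of planar trees up to the order of the subtrees at each node. -/
inductive PlanarTree.Rel {𝔏 : Type*} : PlanarTree 𝔏 → PlanarTree 𝔏 → Prop
  | perm (l : 𝔏) {ts ts' : List (PlanarTree 𝔏)} : ts.Perm ts' → Rel (node l ts) (node l ts')
  | congr (l : 𝔏) (xs ys : List (PlanarTree 𝔏)) {t t' : PlanarTree 𝔏} :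
      Rel t t' → Rel (node l (xs ++ t :: ys)) (node l (xs ++ t' :: ys))

/-- (Non-planar) `𝔏`-decorated rooted trees: the quotient by the equivalence relation generated
by `PlanarTree.Rel`. -/
def DecTree (𝔏 : Type*) : Type _ := Quot (PlanarTree.Rel (𝔏 := 𝔏))

namespace DecTree

variable {𝔏 : Type*}

/-- The class of a planar tree. -/
def mk (p : PlanarTree 𝔏) : DecTree 𝔏 := Quot.mk _ p

/-- A planar representative of a tree. -/
def out (τ : DecTree 𝔏) : PlanarTree 𝔏 := Quot.out τ

theorem mk_out (τ : DecTree 𝔏) : mk τ.out = τ := Quot.out_eq τ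

/-- The decoration of the root. -/
def root : DecTree 𝔏 → 𝔏 :=
  Quot.lift (fun | .node l _ => l) fun _ _ h => by cases h <;> rfl

/-- The multiset of the subtrees `τ_1, …, τ_k` of `τ = Ξ_l ∏ ℐ(τ_j)`. -/
def children : DecTree 𝔏 → Multiset (DecTree 𝔏) :=
  Quot.lift (fun | .node _ ts => ((ts.map mk : List (DecTree 𝔏)) : Multiset (DecTree 𝔏)))
    fun _ _ h => by
      cases h with
      | perm l hp => exact Multiset.coe_eq_coe.mpr (hp.map _)
      | congr l xs ys h =>
        have : mk _ = mk _ := Quot.sound h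
        simp only [List.map_append, List.map_cons, this]

/-- The tree `Ξ_l ∏ ℐ(τ_j)` with root decorated by `l` and subtrees `τ_1, …, τ_k`. -/
def node (l : 𝔏) (m : Multiset (DecTree 𝔏)) : DecTree 𝔏 :=
  mk (.node l (m.toList.map out))

theorem children_mk (l : 𝔏) (ts : List (PlanarTree 𝔏)) :
    (mk (.node l ts)).children = ((ts.map mk : List (DecTree 𝔏)) : Multiset (DecTree 𝔏)) := rfl

@[simp] theorem root_node (l : 𝔏) (m : Multiset (DecTree 𝔏)) : (node l m).root = l := rfl

@[simp] theorem children_node (l : 𝔏) (m : Multiset (DecTree 𝔏)) : (node l m).children = m := by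
  rw [node, children_mk, List.map_map]
  have : (mk ∘ out : DecTree 𝔏 → DecTree 𝔏) = id := by
    funext t; exact mk_out t
  rw [this, List.map_id, Multiset.coe_toList]

theorem mk_node_out (l : 𝔏) (xs ys : List (PlanarTree 𝔏)) :
    mk (.node l (xs ++ ys)) = mk (.node l (xs ++ ys.map (out ∘ mk))) := by
  induction ys generalizing xs with
  | nil => rfl
  | cons t ys ih =>
    let f : DecTree 𝔏 → DecTree 𝔏 := Quot.lift (fun t => mk (.node l (xs ++ t :: ys)))
      fun _ _ h => Quot.sound (.congr l xs ys h)
    have h1 : f (mk t) = f (mk (mk t).out) := by rw [mk_out]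
    have h2 : mk (.node l (xs ++ t :: ys)) = mk (.node l (xs ++ (mk t).out :: ys)) := h1
    rw [h2]
    have := ih (xs ++ [(mk t).out])
    simpa only [List.append_assoc, List.cons_append, List.nil_append, List.map_cons,
      Function.comp_apply] using this

@[simp] theorem node_root_children (τ : DecTree 𝔏) : node τ.root τ.children = τ := by
  induction τ using Quot.ind with
  | mk p =>
    obtain ⟨l, ts⟩ := p
    change mk (.node l ((mk (.node l ts)).children.toList.map out)) = mk (.node l ts)
    have h := mk_node_out l [] ts
    rw [List.nil_append, List.nil_append] at h
    refine Eq.trans ?_ h.symm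
    rw [← List.map_map]
    refine Quot.sound (.perm l (List.Perm.map _ ?_))
    rw [← Multiset.coe_eq_coe, Multiset.coe_toList, children_mk]

/-- A tree is the same thing as a root decoration and a multiset of trees. -/
def nodeEquiv : 𝔏 × Multiset (DecTree 𝔏) ≃ DecTree 𝔏 where
  toFun x := node x.1 x.2
  invFun τ := (τ.root, τ.children)
  left_inv x := by simp
  right_inv τ := by simp

end DecTree

/-- The number of nodes of a planar tree. -/
def PlanarTree.numNodes {𝔏 : Type*} : PlanarTree 𝔏 → ℕ
  | .node _ ts => 1 + (ts.attach.map fun t => numNodes t.1).sum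
decreasing_by
  have := List.sizeOf_lt_of_mem t.2
  simp only [PlanarTree.node.sizeOf_spec]
  omega

namespace DecTree

variable {𝔏 : Type*}

theorem numNodes_aux (l : 𝔏) (ts : List (PlanarTree 𝔏)) :
    (PlanarTree.node l ts).numNodes = 1 + (ts.map PlanarTree.numNodes).sum := by
  rw [PlanarTree.numNodes, List.attach_map_val]

/-- The number of nodes of a tree. -/
def numNodes : DecTree 𝔏 → ℕ :=
  Quot.lift PlanarTree.numNodes fun _ _ h => by
    induction h with
    | perm l hp => rw [numNodes_aux, numNodes_aux, (hp.map _).sum_eq]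
    | congr l xs ys _ ih => simp [numNodes_aux, ih]

theorem numNodes_eq (τ : DecTree 𝔏) : τ.numNodes = 1 + (τ.children.map numNodes).sum := by
  induction τ using Quot.ind with
  | mk p =>
    obtain ⟨l, ts⟩ := p
    change (PlanarTree.node l ts).numNodes = 1 + ((mk (.node l ts)).children.map numNodes).sum
    rw [numNodes_aux, children_mk, Multiset.map_coe, Multiset.sum_coe, List.map_map]
    rfl

theorem numNodes_lt {t τ : DecTree 𝔏} (h : t ∈ τ.children) : t.numNodes < τ.numNodes := by
  rw [numNodes_eq τ]
  have := Multiset.single_le_sum (fun x _ => Nat.zero_le x) _ (Multiset.mem_map_of_mem numNodes h)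
  omega

@[elab_as_elim]
theorem ind {P : DecTree 𝔏 → Prop} (h : ∀ l m, (∀ t ∈ m, P t) → P (node l m)) (τ : DecTree 𝔏) :
    P τ := by
  rw [← node_root_children τ]
  exact h _ _ fun t ht => ind h t
termination_by τ.numNodes
decreasing_by exact numNodes_lt ht

open scoped Classical in
/-- The symmetry factor: `σ(Ξ_l ∏ ℐ(τ_j)) = I! ∏ σ(τ_j)` with `I = ∑ e_{τ_j}`. -/
def symFactor (τ : DecTree 𝔏) : ℕ :=
  (∏ t ∈ τ.children.toFinset, (τ.children.count t).factorial) *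
    (τ.children.attach.map fun t => symFactor t.1).prod
termination_by τ.numNodes
decreasing_by exact numNodes_lt t.2

/-- The multi-index `β` with `β(l,k)` the number of nodes decorated by `l` with `k` children. -/
def fertility (τ : DecTree 𝔏) : 𝔏 × ℕ →₀ ℕ :=
  Finsupp.single (τ.root, Multiset.card τ.children) 1 +
    (τ.children.attach.map fun t => fertility t.1).sum
termination_by τ.numNodes
decreasing_by exact numNodes_lt t.2

open scoped Classical in
theorem symFactor_node (l : 𝔏) (m : Multiset (DecTree 𝔏)) : (node l m).symFactor =
    (∏ t ∈ m.toFinset, (m.count t).factorial) * (m.map symFactor).prod := by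
  rw [symFactor, children_node, Multiset.attach_map_val']

theorem fertility_node (l : 𝔏) (m : Multiset (DecTree 𝔏)) : (node l m).fertility =
    Finsupp.single (l, Multiset.card m) 1 + (m.map fertility).sum := by
  rw [fertility, children_node, Multiset.attach_map_val', root_node]

theorem bracket_fertility (τ : DecTree 𝔏) : bracket τ.fertility = 1 := by
  induction τ using DecTree.ind with
  | h l m ih =>
    rw [fertility_node, bracket_add, bracket_single]
    have : bracket (m.map fertility).sum = Multiset.card m := by
      induction m using Multiset.induction with
      | empty => simp [bracket]
      | cons t m ihm =>
        rw [Multiset.map_cons, Multiset.sum_cons, bracket_add, ih t (Multiset.mem_cons_self t m),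
          ihm fun s hs => ih s (Multiset.mem_cons_of_mem hs), Multiset.card_cons]
        push_cast; ring
    rw [this]; push_cast; ring

end DecTree

/-- The linear span `ℬ` of the trees. -/
def TreeSpace (𝔏 : Type*) : Type _ := DecTree 𝔏 →₀ ℝ

variable {𝔏 : Type*}

instance : AddCommGroup (TreeSpace 𝔏) := inferInstanceAs (AddCommGroup (DecTree 𝔏 →₀ ℝ))
instance : Module ℝ (TreeSpace 𝔏) := inferInstanceAs (Module ℝ (DecTree 𝔏 →₀ ℝ))

/-- The basis of `ℬ` formed by the trees. -/
def treeBasis (𝔏 : Type*) : Module.Basis (DecTree 𝔏) ℝ (TreeSpace 𝔏) :=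
  Module.Basis.ofRepr (LinearEquiv.refl ℝ (DecTree 𝔏 →₀ ℝ))

/-- The linear extension of `t ↦ Ξ_l ℐ(t) ∏_{s ∈ m} ℐ(s)`. -/
def TreeSpace.attachTo (l : 𝔏) (m : Multiset (DecTree 𝔏)) : TreeSpace 𝔏 →ₗ[ℝ] TreeSpace 𝔏 :=
  (treeBasis 𝔏).constr ℝ fun t => treeBasis 𝔏 (DecTree.node l (t ::ₘ m))

open scoped Classical in
/-- The grafting `a ↷ τ` of a tree `a` on a tree `τ = Ξ_l ∏ ℐ(τ_j)`:
`Ξ_l ℐ(a) ∏ ℐ(τ_j) + ∑_j Ξ_l ℐ(a ↷ τ_j) ∏_{i ≠ j} ℐ(τ_i)`. -/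
def DecTree.graft (a τ : DecTree 𝔏) : TreeSpace 𝔏 :=
  treeBasis 𝔏 (DecTree.node τ.root (a ::ₘ τ.children)) +
    (τ.children.attach.map fun t =>
      TreeSpace.attachTo τ.root (τ.children.erase t.1) (DecTree.graft a t.1)).sum
termination_by τ.numNodes
decreasing_by exact numNodes_lt t.2

open scoped Classical in
theorem DecTree.graft_node (a : DecTree 𝔏) (l : 𝔏) (m : Multiset (DecTree 𝔏)) :
    DecTree.graft a (DecTree.node l m) = treeBasis 𝔏 (DecTree.node l (a ::ₘ m)) +
      (m.map fun t => TreeSpace.attachTo l (m.erase t) (DecTree.graft a t)).sum := by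
  rw [DecTree.graft, DecTree.children_node, DecTree.root_node]
  congr 2
  exact Multiset.attach_map_val' m fun t => TreeSpace.attachTo l (m.erase t) (DecTree.graft a t)

/-- The grafting product on `ℬ`, as a bilinear map. -/
def TreeSpace.graft (𝔏 : Type*) : TreeSpace 𝔏 →ₗ[ℝ] TreeSpace 𝔏 →ₗ[ℝ] TreeSpace 𝔏 :=
  (treeBasis 𝔏).constr ℝ fun a => (treeBasis 𝔏).constr ℝ fun τ => DecTree.graft a τ

namespace TreeSpace

/-- The grafting pre-Lie product `x ↷ y` on `ℬ`. -/
instance : Mul (TreeSpace 𝔏) where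
  mul x y := graft 𝔏 x y

theorem mul_def (x y : TreeSpace 𝔏) : x * y = graft 𝔏 x y := rfl

theorem treeBasis_mul (a τ : DecTree 𝔏) : treeBasis 𝔏 a * treeBasis 𝔏 τ = DecTree.graft a τ := by
  rw [mul_def, graft, Module.Basis.constr_basis, Module.Basis.constr_basis]

@[elab_as_elim]
theorem basis_induction {p : TreeSpace 𝔏 → Prop} (x : TreeSpace 𝔏)
    (zero : p 0) (basis : ∀ τ, p (treeBasis 𝔏 τ)) (add : ∀ x y, p x → p y → p (x + y))
    (smul : ∀ (r : ℝ) x, p x → p (r • x)) : p x := by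
  have hx : x ∈ Submodule.span ℝ (Set.range (treeBasis 𝔏)) := by
    rw [Module.Basis.span_eq]; exact Submodule.mem_top
  induction hx using Submodule.span_induction with
  | mem x h => obtain ⟨τ, rfl⟩ := h; exact basis τ
  | zero => exact zero
  | add x y _ _ hx hy => exact add x y hx hy
  | smul r x _ hx => exact smul r x hx

/-- Attaching the first argument as a new subtree of the root of the second one. -/
def rootGraft (𝔏 : Type*) : TreeSpace 𝔏 →ₗ[ℝ] TreeSpace 𝔏 →ₗ[ℝ] TreeSpace 𝔏 :=
  (treeBasis 𝔏).constr ℝ fun t => (treeBasis 𝔏).constr ℝ fun s =>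
    treeBasis 𝔏 (DecTree.node s.root (t ::ₘ s.children))

theorem rootGraft_basis (t : DecTree 𝔏) (l : 𝔏) (m : Multiset (DecTree 𝔏)) :
    rootGraft 𝔏 (treeBasis 𝔏 t) (treeBasis 𝔏 (DecTree.node l m)) =
      treeBasis 𝔏 (DecTree.node l (t ::ₘ m)) := by
  rw [rootGraft, Module.Basis.constr_basis, Module.Basis.constr_basis, DecTree.root_node,
    DecTree.children_node]

theorem rootGraft_node (x : TreeSpace 𝔏) (l : 𝔏) (m : Multiset (DecTree 𝔏)) :
    rootGraft 𝔏 x (treeBasis 𝔏 (DecTree.node l m)) = attachTo l m x := by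
  have : (rootGraft 𝔏).flip (treeBasis 𝔏 (DecTree.node l m)) = attachTo l m := by
    refine (treeBasis 𝔏).ext fun t => ?_
    rw [LinearMap.flip_apply, rootGraft_basis, attachTo, Module.Basis.constr_basis]
  exact LinearMap.congr_fun this x

theorem rootGraft_attachTo (t : DecTree 𝔏) (x : TreeSpace 𝔏) (l : 𝔏) (m : Multiset (DecTree 𝔏)) :
    rootGraft 𝔏 (treeBasis 𝔏 t) (attachTo l m x) = attachTo l (t ::ₘ m) x := by
  have : (rootGraft 𝔏 (treeBasis 𝔏 t)) ∘ₗ attachTo l m = attachTo l (t ::ₘ m) := by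
    refine (treeBasis 𝔏).ext fun s => ?_
    rw [LinearMap.comp_apply, attachTo, attachTo, Module.Basis.constr_basis,
      Module.Basis.constr_basis, rootGraft_basis, Multiset.cons_swap]
  exact LinearMap.congr_fun this x

theorem graft_rootGraft (x y z : TreeSpace 𝔏) : graft 𝔏 x (rootGraft 𝔏 y z) =
    rootGraft 𝔏 (graft 𝔏 x y) z + rootGraft 𝔏 y (graft 𝔏 x z) := by
  classical
  have key : ∀ a t s : DecTree 𝔏,
      graft 𝔏 (treeBasis 𝔏 a) (rootGraft 𝔏 (treeBasis 𝔏 t) (treeBasis 𝔏 s)) =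
      rootGraft 𝔏 (graft 𝔏 (treeBasis 𝔏 a) (treeBasis 𝔏 t)) (treeBasis 𝔏 s) +
        rootGraft 𝔏 (treeBasis 𝔏 t) (graft 𝔏 (treeBasis 𝔏 a) (treeBasis 𝔏 s)) := by
    intro a t s
    rw [← DecTree.node_root_children s]
    generalize s.root = l
    generalize s.children = m
    rw [rootGraft_basis, ← mul_def, ← mul_def, ← mul_def, treeBasis_mul, treeBasis_mul,
      treeBasis_mul, rootGraft_node, DecTree.graft_node, DecTree.graft_node, map_add,
      rootGraft_basis, Multiset.map_cons, Multiset.sum_cons, Multiset.erase_cons_head,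
      Multiset.cons_swap a t m, map_multiset_sum, Multiset.map_map]
    have : (m.map fun u => attachTo l ((t ::ₘ m).erase u) (DecTree.graft a u)) =
        m.map ((rootGraft 𝔏 (treeBasis 𝔏 t)) ∘
          fun u => attachTo l (m.erase u) (DecTree.graft a u)) := by
      refine Multiset.map_congr rfl fun u hu => ?_
      rw [Function.comp_apply, rootGraft_attachTo, Multiset.erase_cons_tail_of_mem hu]
    rw [← this]
    abel
  induction x using basis_induction with
  | zero => simp
  | add x x' hx hx' => simp only [map_add, LinearMap.add_apply, hx, hx']; abel
  | smul r x hx => simp only [map_smul, LinearMap.smul_apply, hx, smul_add]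
  | basis a =>
    induction y using basis_induction with
    | zero => simp
    | add y y' hy hy' => simp only [map_add, LinearMap.add_apply, hy, hy']; abel
    | smul r y hy => simp only [map_smul, LinearMap.smul_apply, hy, smul_add]
    | basis t =>
      induction z using basis_induction with
      | zero => simp
      | add z z' hz hz' => simp only [map_add, hz, hz']; abel
      | smul r z hz => simp only [map_smul, hz, smul_add]
      | basis s => exact key a t s

theorem graft_leaf (x : TreeSpace 𝔏) (l : 𝔏) :
    graft 𝔏 x (treeBasis 𝔏 (DecTree.node l 0)) =
      rootGraft 𝔏 x (treeBasis 𝔏 (DecTree.node l 0)) := by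
  have : (graft 𝔏).flip (treeBasis 𝔏 (DecTree.node l 0)) =
      (rootGraft 𝔏).flip (treeBasis 𝔏 (DecTree.node l 0)) := by
    refine (treeBasis 𝔏).ext fun t => ?_
    rw [LinearMap.flip_apply, LinearMap.flip_apply, rootGraft_basis, ← mul_def, treeBasis_mul,
      DecTree.graft_node]
    simp
  exact LinearMap.congr_fun this x

theorem rootGraft_comm (x y z : TreeSpace 𝔏) :
    rootGraft 𝔏 x (rootGraft 𝔏 y z) = rootGraft 𝔏 y (rootGraft 𝔏 x z) := by
  induction x using basis_induction with
  | zero => simp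
  | add x x' hx hx' => simp only [map_add, LinearMap.add_apply, hx, hx']
  | smul r x hx => simp only [map_smul, LinearMap.smul_apply, hx]
  | basis a =>
    induction y using basis_induction with
    | zero => simp
    | add y y' hy hy' => simp only [map_add, LinearMap.add_apply, hy, hy']
    | smul r y hy => simp only [map_smul, LinearMap.smul_apply, hy]
    | basis t =>
      induction z using basis_induction with
      | zero => simp
      | add z z' hz hz' => simp only [map_add, hz, hz']
      | smul r z hz => simp only [map_smul, hz]
      | basis s =>
        rw [← DecTree.node_root_children s, rootGraft_basis, rootGraft_basis, rootGraft_basis,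
          rootGraft_basis, Multiset.cons_swap]

theorem preLie (x y z : TreeSpace 𝔏) :
    graft 𝔏 (graft 𝔏 x y) z - graft 𝔏 x (graft 𝔏 y z) =
      graft 𝔏 (graft 𝔏 y x) z - graft 𝔏 y (graft 𝔏 x z) := by
  have key : ∀ c : DecTree 𝔏, ∀ x y : TreeSpace 𝔏,
      graft 𝔏 (graft 𝔏 x y) (treeBasis 𝔏 c) - graft 𝔏 x (graft 𝔏 y (treeBasis 𝔏 c)) =
      graft 𝔏 (graft 𝔏 y x) (treeBasis 𝔏 c) - graft 𝔏 y (graft 𝔏 x (treeBasis 𝔏 c)) := by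
    intro c
    induction c using DecTree.ind with
    | h l m ih =>
      induction m using Multiset.induction with
      | empty =>
        intro x y
        simp only [graft_leaf, graft_rootGraft]
        rw [rootGraft_comm x y]
        abel
      | cons t m ihm =>
        intro x y
        have h1 := ih t (Multiset.mem_cons_self t m) x y
        have h2 := ihm (fun s hs => ih s (Multiset.mem_cons_of_mem hs)) x y
        rw [sub_eq_iff_eq_add] at h1 h2
        rw [← rootGraft_basis]
        simp only [graft_rootGraft, map_add, h1, h2, LinearMap.add_apply, map_sub,
          LinearMap.sub_apply]
        abel
  induction z using basis_induction with
  | zero => simp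
  | add z z' hz hz' =>
    rw [sub_eq_iff_eq_add] at hz hz'
    simp only [map_add, hz, hz']
    abel
  | smul r z hz =>
    simp only [map_smul, ← smul_sub, hz]
  | basis c => exact key c x y

instance : LeftPreLieRing (TreeSpace 𝔏) where
  left_distrib x y z := by simp only [mul_def, map_add]
  right_distrib x y z := by simp only [mul_def, map_add, LinearMap.add_apply]
  zero_mul x := by simp only [mul_def, map_zero, LinearMap.zero_apply]
  mul_zero x := by simp only [mul_def, map_zero]
  assoc_symm' x y z := preLie x y z

instance : LeftPreLieAlgebra ℝ (TreeSpace 𝔏) where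
  smul_assoc r x y := by simp only [smul_eq_mul, mul_def, map_smul, LinearMap.smul_apply]
  smul_comm r x y := by simp only [smul_eq_mul, mul_def, map_smul]

end TreeSpace

end Trees

section Psi

variable (𝔏 : Type*)

/-- `Ψ : ℬ → T`, the linear map with `Ψ[τ] = σ(β) z^β` where `β` is the multi-index of the tree `τ`
and `σ(β) = ∏_{(l,k)} (k!) ^ β(l,k)`. -/
def psi : TreeSpace 𝔏 →ₗ[ℝ] MultiIndexSpace 𝔏 :=
  (treeBasis 𝔏).constr ℝ fun τ =>
    (τ.fertility.prod fun x n => (x.2.factorial : ℝ) ^ n) •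
      zBasis 𝔏 ⟨τ.fertility, τ.bracket_fertility⟩

end Psi

section HopfAlgebras

/-- A Hopf algebra structure over `ℝ` on a given commutative `ℝ`-algebra. -/
structure HopfStructure (A : Type*) [CommRing A] [Algebra ℝ A] where
  comul : A →ₐ[ℝ] A ⊗[ℝ] A
  counit : A →ₐ[ℝ] ℝ
  antipode : A →ₗ[ℝ] A
  coassoc : (Algebra.TensorProduct.assoc ℝ ℝ ℝ A A A).toAlgHom.comp
    ((Algebra.TensorProduct.map comul (.id ℝ A)).comp comul) =
      (Algebra.TensorProduct.map (.id ℝ A) comul).comp comul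
  rTensor_counit_comp_comul : (Algebra.TensorProduct.map counit (.id ℝ A)).comp comul =
    (Algebra.TensorProduct.lid ℝ A).symm
  lTensor_counit_comp_comul : (Algebra.TensorProduct.map (.id ℝ A) counit).comp comul =
    (Algebra.TensorProduct.rid ℝ ℝ A).symm
  mul_antipode_rTensor_comul : LinearMap.mul' ℝ A ∘ₗ antipode.rTensor A ∘ₗ comul.toLinearMap =
    Algebra.linearMap ℝ A ∘ₗ counit.toLinearMap
  mul_antipode_lTensor_comul : LinearMap.mul' ℝ A ∘ₗ antipode.lTensor A ∘ₗ comul.toLinearMap =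
    Algebra.linearMap ℝ A ∘ₗ counit.toLinearMap

/-- The corresponding Mathlib structure. -/
abbrev HopfStructure.toHopfAlgebra {A : Type*} [CommRing A] [Algebra ℝ A] (H : HopfStructure A) :
    HopfAlgebra ℝ A :=
  { Bialgebra.ofAlgHom H.comul H.counit H.coassoc H.rTensor_counit_comp_comul
      H.lTensor_counit_comp_comul with
    antipode := H.antipode
    mul_antipode_rTensor_comul := H.mul_antipode_rTensor_comul
    mul_antipode_lTensor_comul := H.mul_antipode_lTensor_comul }

/-- Hopf algebra morphisms: algebra morphisms compatible with the comultiplications, the counits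
and the antipodes. -/
structure HopfStructure.IsHom {A B : Type*} [CommRing A] [Algebra ℝ A] [CommRing B] [Algebra ℝ B]
    (H : HopfStructure A) (K : HopfStructure B) (φ : A →ₐ[ℝ] B) : Prop where
  comul : K.comul.comp φ = (Algebra.TensorProduct.map φ φ).comp H.comul
  counit : K.counit.comp φ = H.counit
  antipode : ∀ a, K.antipode (φ a) = φ (H.antipode a)

/-- `Δ` is the transpose, with respect to a pairing `⟨·,·⟩ : U × A → ℝ`, of the multiplication of
`U`: `⟨u ⊗ v, Δ p⟩ = ⟨u v, p⟩`. -/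
def IsTransposeOfMul {U A : Type*} [Ring U] [Algebra ℝ U] [CommRing A] [Algebra ℝ A]
    (P : U →ₗ[ℝ] A →ₗ[ℝ] ℝ) (Δ : A →ₐ[ℝ] A ⊗[ℝ] A) : Prop :=
  ∀ (u v : U) (p : A), LinearMap.mul' ℝ ℝ (TensorProduct.map (P u) (P v) (Δ p)) = P (u * v) p

variable (𝔏 : Type*)

/-- The operator `B₊ˡ`: it sends a forest `τ_1 ⋯ τ_k` to the tree `Ξ_l ∏ ℐ(τ_j)`. -/
def bPlus {𝔏 : Type*} (l : 𝔏) :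
    MvPolynomial (DecTree 𝔏) ℝ →ₗ[ℝ] MvPolynomial (DecTree 𝔏) ℝ :=
  (MvPolynomial.basisMonomials (DecTree 𝔏) ℝ).constr ℝ fun I =>
    MvPolynomial.X (DecTree.node l (Finsupp.toMultiset I))

/-- The Connes–Kreimer coproduct of a tree `τ = B₊ˡ(τ_1 ⋯ τ_k)`:
`Δ τ = τ ⊗ 1 + (id ⊗ B₊ˡ) (Δ τ_1 ⋯ Δ τ_k)`. -/
def ckTree {𝔏 : Type*} (τ : DecTree 𝔏) :
    MvPolynomial (DecTree 𝔏) ℝ ⊗[ℝ] MvPolynomial (DecTree 𝔏) ℝ :=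
  MvPolynomial.X τ ⊗ₜ 1 + (bPlus τ.root).lTensor (MvPolynomial (DecTree 𝔏) ℝ)
    (τ.children.attach.map fun t => ckTree t.1).prod
termination_by τ.numNodes
decreasing_by exact DecTree.numNodes_lt t.2

theorem ckTree_node {𝔏 : Type*} (l : 𝔏) (m : Multiset (DecTree 𝔏)) : ckTree (DecTree.node l m) =
    MvPolynomial.X (DecTree.node l m) ⊗ₜ 1 +
      (bPlus l).lTensor (MvPolynomial (DecTree 𝔏) ℝ) (m.map ckTree).prod := by
  rw [ckTree, DecTree.children_node, Multiset.attach_map_val', DecTree.root_node]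

/-- The Connes–Kreimer coproduct on the polynomial algebra `ℝ[ℋ]` generated by the trees. -/
def ckComul : MvPolynomial (DecTree 𝔏) ℝ →ₐ[ℝ]
    MvPolynomial (DecTree 𝔏) ℝ ⊗[ℝ] MvPolynomial (DecTree 𝔏) ℝ :=
  MvPolynomial.aeval ckTree

/-- The canonical pairing of `U(T, D)` with `ℝ[𝒯]`: `⟨A_I, z^J⟩ = δ_{I J}` for the Guin–Oudom basis
`(A_I)` over the basis `(z^β)` of `T`. -/
def multiIndexPairing : Env (MultiIndexSpace 𝔏) →ₗ[ℝ] MvPolynomial (Populated 𝔏) ℝ →ₗ[ℝ] ℝ :=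
  goPairing (zBasis 𝔏) fun _ => 1

/-- The pairing of `U(ℬ, ↷)` with `ℝ[ℋ]` extending `⟨τ', τ⟩ = δ_{τ' τ} σ(τ)`:
`⟨A_I, ∏ τ ^ J(τ)⟩ = δ_{I J} ∏ σ(τ) ^ I(τ)` for the Guin–Oudom basis `(A_I)` over the trees, i.e.
`⟨τ_1 ⋆ ⋯ ⋆ τ_k, τ_1 ⋯ τ_k⟩ = I! σ(τ_1) ⋯ σ(τ_k)` with `I = ∑ e_{τ_j}`. -/
def treePairing : Env (TreeSpace 𝔏) →ₗ[ℝ] MvPolynomial (DecTree 𝔏) ℝ →ₗ[ℝ] ℝ :=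
  goPairing (treeBasis 𝔏) fun τ => (τ.symFactor : ℝ)

end HopfAlgebras

end

/-! The Hopf structures on the polynomial algebras are read off from the enveloping algebras by
duality, and no coproduct on `Env L` is ever introduced. Two adjoint operations on polynomials
replace it. The right operation `u ↦ u ⋆ a` is adjoint to a constant-coefficient derivation
(`goPairing_goStar`). The rule `(a u) ⋆ c = a (u ⋆ c) - u ⋆ (a ▷ c)` then forces the adjoint `θ_a`
of left multiplication by `a ∈ L` to be a derivation as well (`leibniz_of_adjoint_mulLeft`). Since
`L` generates `Env L`, multiplicativity of the transposed product, of the transpose of a morphism,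
and the antipode identities all follow by induction on left factors `a u`, each step being a Leibniz
rule for `θ_a`.

Transposes exist in infinite dimension because of a connected grading of finite type: the number of
nodes for trees, the total degree for multi-indices. A product or a degree-preserving map then meets
only finitely many basis elements for each monomial (`exists_isDualComul`, `exists_adjoint`). `Ψ`
respects the gradings because each node contributes exactly one variable.

`Ψ` is a pre-Lie morphism because grafting obeys a Leibniz rule: a new child at a node with `k`
children turns `k! z_(l,k)` into `(k+1)! z_(l,k+1)`, which is the action of `D` on that factor
(`psiPoly_graft`).

The dual coproduct on trees is identified with that of Connes–Kreimer through `B₊`. Its adjoint cuts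
off the root, with the symmetry factors absorbing the multiplicities (`treePairing_bPlus`). Root
cutting satisfies `cutRoot l (x ↷ y) = x · cutRoot l y`, which dualizes to the Hochschild cocycle
identity for `B₊` (`IsDualComul.comul_bPlus`), and this is the recursion defining `ckComul`. -/

noncomputable section

/-! ### One-sided evaluation of tensors -/

section Slices

variable {M N K : Type*} [AddCommGroup M] [Module ℝ M] [AddCommGroup N] [Module ℝ N]
  [AddCommGroup K] [Module ℝ K]

/-- Evaluation of a linear form on the left tensor factor. -/
def leftSlice (N : Type*) [AddCommGroup N] [Module ℝ N] (f : M →ₗ[ℝ] ℝ) : M ⊗[ℝ] N →ₗ[ℝ] N :=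
  (TensorProduct.lid ℝ N).toLinearMap ∘ₗ f.rTensor N

/-- Evaluation of a linear form on the right tensor factor. -/
def rightSlice (M : Type*) [AddCommGroup M] [Module ℝ M] (f : N →ₗ[ℝ] ℝ) : M ⊗[ℝ] N →ₗ[ℝ] M :=
  (TensorProduct.rid ℝ M).toLinearMap ∘ₗ f.lTensor M

@[simp] theorem leftSlice_tmul (f : M →ₗ[ℝ] ℝ) (m : M) (n : N) :
    leftSlice N f (m ⊗ₜ n) = f m • n := by simp [leftSlice]

@[simp] theorem rightSlice_tmul (f : N →ₗ[ℝ] ℝ) (m : M) (n : N) :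
    rightSlice M f (m ⊗ₜ n) = f n • m := by simp [rightSlice]

theorem leftSlice_lTensor (f : M →ₗ[ℝ] ℝ) (g : N →ₗ[ℝ] K) (t : M ⊗[ℝ] N) :
    leftSlice K f (g.lTensor M t) = g (leftSlice N f t) := by
  induction t using TensorProduct.induction_on with
  | zero => simp
  | tmul m n => simp
  | add s t hs ht => simp only [map_add, hs, ht]

theorem mul'_map_eq_leftSlice (f : M →ₗ[ℝ] ℝ) (g : N →ₗ[ℝ] ℝ) (t : M ⊗[ℝ] N) :
    LinearMap.mul' ℝ ℝ (TensorProduct.map f g t) = g (leftSlice N f t) := by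
  induction t using TensorProduct.induction_on with
  | zero => simp
  | tmul m n => simp
  | add s t hs ht => simp only [map_add, hs, ht]

theorem apply_leftSlice (f : M →ₗ[ℝ] ℝ) (g : N →ₗ[ℝ] ℝ) (t : M ⊗[ℝ] N) :
    g (leftSlice N f t) = f (rightSlice M g t) := by
  induction t using TensorProduct.induction_on with
  | zero => simp
  | tmul m n => simp [mul_comm]
  | add s t hs ht => simp only [map_add, hs, ht]

end Slices

/-! ### Transposes with respect to diagonal pairings -/

section Transpose

variable {V W V' κ κ' : Type*} [AddCommGroup V] [Module ℝ V] [AddCommGroup W] [Module ℝ W]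
  [AddCommGroup V'] [Module ℝ V']

/-- If `P` pairs two bases diagonally, every bilinear form that is finitely supported in its first
argument is represented by a linear map. -/
theorem exists_transpose (v : Module.Basis κ ℝ V) (w : Module.Basis κ ℝ W)
    (v' : Module.Basis κ' ℝ V') (P : V →ₗ[ℝ] W →ₗ[ℝ] ℝ)
    (hne : ∀ i, P (v i) (w i) ≠ 0) (hdiag : ∀ i j, i ≠ j → P (v i) (w j) = 0)
    (Q : V →ₗ[ℝ] V' →ₗ[ℝ] ℝ) (hfin : ∀ k, {i | Q (v i) (v' k) ≠ 0}.Finite) :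
    ∃ T : V' →ₗ[ℝ] W, ∀ x p, P x (T p) = Q x p := by
  classical
  -- The expansion in the basis dual to `v`, namely `w i / P (v i) (w i)`; `hfin` makes the sum
  -- finite.
  refine ⟨v'.constr ℝ fun k => ∑ i ∈ (hfin k).toFinset, (Q (v i) (v' k) / P (v i) (w i)) • w i, ?_⟩
  have h : P.compl₂ (v'.constr ℝ fun k =>
      ∑ i ∈ (hfin k).toFinset, (Q (v i) (v' k) / P (v i) (w i)) • w i) = Q := by
    refine v.ext fun i => v'.ext fun k => ?_
    rw [LinearMap.compl₂_apply, Module.Basis.constr_basis, map_sum]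
    by_cases hi : Q (v i) (v' k) = 0
    · rw [hi]
      refine Finset.sum_eq_zero fun j hj => ?_
      have hij : i ≠ j := by
        rintro rfl
        exact (Set.Finite.mem_toFinset _).mp hj hi
      rw [map_smul, hdiag i j hij, smul_zero]
    · rw [Finset.sum_eq_single i]
      · rw [map_smul, smul_eq_mul, div_mul_cancel₀ _ (hne i)]
      · intro j _ hj
        rw [map_smul, hdiag i j hj.symm, smul_zero]
      · intro hn
        exact absurd (by simpa using hi) hn
  intro x p
  exact LinearMap.congr_fun (LinearMap.congr_fun h x) p

end Transpose

/-! ### Finiteness of multi-indices of bounded weight -/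

section Weights

variable {σ : Type*}

/-- An index in the support has weight at most `n`, so everything is pushed forward from
multi-indices over a finite set, where positivity of `d` bounds the entries. -/
theorem finite_weight_le {d : σ → ℕ} (hpos : ∀ i, d i ≠ 0) {n : ℕ} (hfin : {i | d i ≤ n}.Finite) :
    {I : σ →₀ ℕ | Finsupp.weight d I ≤ n}.Finite := by
  classical
  have := hfin.to_subtype
  refine ((Finsupp.finite_of_nat_weight_le (fun i : {i | d i ≤ n} => d i) (fun i => hpos i)
    n).image (Finsupp.mapDomain Subtype.val)).subset fun I hI => ?_
  have hsupp : ∀ i ∈ I.support, d i ≤ n := fun i hi =>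
    (Finsupp.le_weight_of_ne_zero' d (Finsupp.mem_support_iff.mp hi)).trans hI
  have h : Finsupp.mapDomain Subtype.val
      (I.comapDomain (Subtype.val : {i | d i ≤ n} → σ) Subtype.val_injective.injOn) = I :=
    Finsupp.mapDomain_comapDomain _ Subtype.val_injective _ fun i hi => by
      simpa using hsupp i hi
  refine ⟨I.comapDomain Subtype.val Subtype.val_injective.injOn, ?_, h⟩
  simp only [Set.mem_ofPred_eq] at hI ⊢
  rw [← h] at hI
  rwa [Finsupp.weight_apply, Finsupp.sum_mapDomain_index (by simp) (by simp [add_mul])] at hI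

end Weights

/-! ### The Guin–Oudom pairing and adjoint derivations -/

section Pairing

variable {L : Type*} [LeftPreLieRing L] [LeftPreLieAlgebra ℝ L] {ι : Type*}

attribute [local instance 100] LieRing.ofAssociativeRing

open MvPolynomial

theorem goProd_zero (b : ι → L) : goProd b 0 = 1 := rfl

theorem goElem_zero (b : ι → L) : goElem b 0 = 1 := by simp [goElem, goProd_zero]

theorem goProd_toMultiset (b : ι → L) (I : ι →₀ ℕ) :
    goProd b (Finsupp.toMultiset I) = (I.prod fun _ n => (n.factorial : ℝ)) • goElem b I := by
  have hne : (I.prod fun _ n => (n.factorial : ℝ)) ≠ 0 :=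
    Finset.prod_ne_zero_iff.mpr fun i _ => by positivity
  rw [goElem, smul_smul, mul_inv_cancel₀ hne, one_smul]

theorem prod_factorial_add_single (I : ι →₀ ℕ) (i : ι) :
    ((I + Finsupp.single i 1).prod fun _ n => (n.factorial : ℝ)) =
      (I i + 1) * I.prod fun _ n => (n.factorial : ℝ) := by
  classical
  rw [Finsupp.prod_of_support_subset (I + Finsupp.single i 1) (s := insert i I.support) _ _
    (by simp), Finsupp.prod_of_support_subset I (s := insert i I.support)
    (Finset.subset_insert _ _) _ (by simp), ← Finset.mul_prod_erase _ _
    (Finset.mem_insert_self i _), ← Finset.mul_prod_erase _ _ (Finset.mem_insert_self i _)]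
  · rw [← mul_assoc]
    congr 1
    · simp [Nat.factorial_succ]
    · refine Finset.prod_congr rfl fun j hj => ?_
      rw [Finsupp.add_apply, Finsupp.single_eq_of_ne (Finset.ne_of_mem_erase hj), add_zero]
  · intro j hj
    simp only [Finsupp.mem_support_iff, Finsupp.add_apply, Finset.mem_insert] at hj ⊢
    by_contra hc
    push Not at hc
    rw [Finsupp.single_eq_of_ne hc.1] at hj
    simp [hc.2] at hj

/-- The factor is the ratio of the normalizations `(I + e_i)!` and `I!`; it is also the factor
produced by differentiating a monomial, whence the adjointness below. -/
theorem goStar_goElem (b : ι → L) (I : ι →₀ ℕ) (i : ι) :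
    goStar (goElem b I) (b i) = ((I i : ℝ) + 1) • goElem b (I + Finsupp.single i 1) := by
  have hne : (I.prod fun _ n => (n.factorial : ℝ)) ≠ 0 :=
    Finset.prod_ne_zero_iff.mpr fun i _ => by positivity
  have hs : Finsupp.toMultiset (I + Finsupp.single i 1) = i ::ₘ Finsupp.toMultiset I := by
    rw [map_add, Finsupp.toMultiset_single, one_smul, add_comm, Multiset.singleton_add]
  have h := goProd_toMultiset b (I + Finsupp.single i 1)
  rw [hs, goProd_cons, goProd_toMultiset, goStar_smul, prod_factorial_add_single, mul_comm,
    mul_smul] at h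
  exact smul_right_injective _ hne h

/-- Linear maps out of `U(L)` are determined by their values on the products
`1 ⋆ a_{i_1} ⋆ ⋯ ⋆ a_{i_k}`. -/
theorem Env.ext_goProd {M : Type*} [AddCommGroup M] [Module ℝ M] (b : Module.Basis ι ℝ L)
    {f g : Env L →ₗ[ℝ] M} (h : ∀ s, f (goProd b s) = g (goProd b s)) : f = g := by
  refine (goBasis b).ext fun I => ?_
  rw [goBasis_apply, goElem, map_smul, map_smul, h]

/-- Induction along the right operation of `L`. -/
theorem Env.induction_goStar (b : Module.Basis ι ℝ L) {p : Env L → Prop} (h1 : p 1)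
    (hadd : ∀ u v, p u → p v → p (u + v)) (hsmul : ∀ (r : ℝ) u, p u → p (r • u))
    (hstar : ∀ u i, p u → p (goStar u (b i))) (u : Env L) : p u := by
  have hprod : ∀ s, p (goProd b s) := fun s => by
    induction s using Multiset.induction with
    | empty => exact h1
    | cons i s ih => rw [goProd_cons]; exact hstar _ _ ih
  have hu : u ∈ Submodule.span ℝ (Set.range (goElem b)) := goElem_span b trivial
  induction hu using Submodule.span_induction with
  | mem x hx => obtain ⟨I, rfl⟩ := hx; exact hsmul _ _ (hprod _)
  | zero => simpa using hsmul 0 1 h1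
  | add x y _ _ hx hy => exact hadd x y hx hy
  | smul r x _ hx => exact hsmul r x hx

variable (b : Module.Basis ι ℝ L) (w : ι → ℝ)

theorem goPairing_goElem (I : ι →₀ ℕ) (p : MvPolynomial ι ℝ) :
    goPairing b w (goElem b I) p = (I.prod fun i n => w i ^ n) * coeff I p := by
  rw [← goBasis_apply, goPairing, Module.Basis.constr_basis]
  rfl

theorem prod_weight_ne_zero {w : ι → ℝ} (hw : ∀ i, w i ≠ 0) (I : ι →₀ ℕ) :
    (I.prod fun i n => w i ^ n) ≠ 0 :=
  Finset.prod_ne_zero_iff.mpr fun i _ => pow_ne_zero _ (hw i)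

theorem goPairing_one_left (p : MvPolynomial ι ℝ) :
    goPairing b w 1 p = constantCoeff p := by
  rw [← goElem_zero b, goPairing_goElem]
  simp [constantCoeff_eq]

/-- The derivations `∂_a` of the polynomial algebra, adjoint to the right operation of `L`. -/
def dualDeriv : L →ₗ[ℝ] Derivation ℝ (MvPolynomial ι ℝ) (MvPolynomial ι ℝ) :=
  b.constr ℝ fun i => w i • pderiv i

/-- The right operation `u ↦ u ⋆ a` as a linear map. -/
def goStarRight (a : L) : Env L →ₗ[ℝ] Env L where
  toFun u := goStar u a
  map_add' u v := goStar_add u v a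
  map_smul' r u := goStar_smul r u a

/-- On basis elements the factor `I i + 1` matches the one in `coeff_pderiv`, and the extra `w i` is
built into `dualDeriv`; linearity in `u` and `a` does the rest. -/
theorem goPairing_goStar (u : Env L) (a : L) (p : MvPolynomial ι ℝ) :
    goPairing b w (goStar u a) p = goPairing b w u (dualDeriv b w a p) := by
  have hbasis : ∀ i u, goPairing b w (goStar u (b i)) p =
      goPairing b w u (dualDeriv b w (b i) p) := by
    intro i
    suffices h : (goPairing b w).flip p ∘ₗ goStarRight (b i) =
        (goPairing b w).flip (dualDeriv b w (b i) p) from fun u => LinearMap.congr_fun h u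
    refine (goBasis b).ext fun I => ?_
    change goPairing b w (goStar (goBasis b I) (b i)) p =
      goPairing b w (goBasis b I) (dualDeriv b w (b i) p)
    rw [goBasis_apply, goStar_goElem, map_smul, LinearMap.smul_apply, goPairing_goElem,
      goPairing_goElem, dualDeriv, Module.Basis.constr_basis, Derivation.smul_apply, coeff_smul,
      coeff_pderiv, Finsupp.prod_add_index' (by simp) (by simp [pow_add]),
      Finsupp.prod_single_index (by simp), pow_one]
    simp only [smul_eq_mul]
    ring
  let g : L →ₗ[ℝ] ℝ :=
    { toFun := fun a => goPairing b w u (dualDeriv b w a p)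
      map_add' := fun x y => by simp
      map_smul' := fun r x => by simp }
  have h : (goPairing b w).flip p ∘ₗ goStar u = g := b.ext fun i => hbasis i u
  exact LinearMap.congr_fun h a

variable {w}

theorem goPairing_ext (hw : ∀ i, w i ≠ 0) {p q : MvPolynomial ι ℝ}
    (h : ∀ u, goPairing b w u p = goPairing b w u q) : p = q := by
  ext I
  have := h (goElem b I)
  rw [goPairing_goElem, goPairing_goElem] at this
  exact mul_left_cancel₀ (prod_weight_ne_zero hw I) this

/-- Slicing by `goElem b I` extracts the component along the monomial `I`, up to a nonzero factor.
Identities between coproducts are all checked this way. -/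
theorem leftSlice_ext (hw : ∀ i, w i ≠ 0) {N : Type*} [AddCommGroup N] [Module ℝ N]
    {s t : MvPolynomial ι ℝ ⊗[ℝ] N}
    (h : ∀ u, leftSlice N (goPairing b w u) s = leftSlice N (goPairing b w u) t) : s = t := by
  classical
  refine (TensorProduct.equivFinsuppOfBasisLeft (basisMonomials ι ℝ)).injective ?_
  ext1 I
  rw [TensorProduct.equivFinsuppOfBasisLeft_apply, TensorProduct.equivFinsuppOfBasisLeft_apply]
  have hI : goPairing b w (goElem b I) =
      (I.prod fun i n => w i ^ n) • (basisMonomials ι ℝ).coord I :=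
    LinearMap.ext fun p => goPairing_goElem b w I p
  have := h (goElem b I)
  rw [hI, leftSlice, LinearMap.rTensor_smul, LinearMap.comp_smul] at this
  exact smul_right_injective _ (prod_weight_ne_zero hw I) this

variable (w)

/-- Moving `a` past `⋆` writes `a u` as a sum of elements of the form `v ⋆ c`, and these pair to
zero with `1` because derivations kill constants. -/
theorem goPairing_of_mul_one (a : L) (u : Env L) : goPairing b w (Env.of a * u) 1 = 0 := by
  induction u using Env.induction_goStar b generalizing a with
  | h1 => rw [mul_one, ← goStar_one, goPairing_goStar]; simp
  | hadd u v hu hv => simp only [mul_add, map_add, LinearMap.add_apply, hu, hv, add_zero]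
  | hsmul r u hu => simp only [mul_smul_comm, map_smul, LinearMap.smul_apply, hu, smul_zero]
  | hstar u i hu =>
    have h : Env.of a * goStar u (b i) = goStar (Env.of a * u) (b i) + goStar u (a * b i) := by
      rw [goStar_of_mul]; abel
    rw [h, map_add, LinearMap.add_apply, goPairing_goStar, goPairing_goStar]
    simp

theorem goPairing_one_one : goPairing b w 1 1 = 1 := by
  rw [goPairing_one_left, map_one]

/-- Pairing with `1` is the counit of the enveloping algebra. -/
theorem goPairing_mul_one (u v : Env L) :
    goPairing b w (u * v) 1 = goPairing b w u 1 * goPairing b w v 1 := by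
  induction u using Env.induction with
  | h1 => rw [one_mul, goPairing_one_one, one_mul]
  | hadd u u' hu hu' => simp only [add_mul, map_add, LinearMap.add_apply, hu, hu']
  | hsmul r u hu =>
    simp only [smul_mul_assoc, map_smul, LinearMap.smul_apply, hu, smul_eq_mul, mul_assoc]
  | hmul a u _ => rw [mul_assoc, goPairing_of_mul_one, goPairing_of_mul_one, zero_mul]

variable {w}

/-- The adjoint of the left multiplication by an element of `L` is a derivation. -/
theorem leibniz_of_adjoint_mulLeft (hw : ∀ i, w i ≠ 0) {a : L}
    {θ : MvPolynomial ι ℝ →ₗ[ℝ] MvPolynomial ι ℝ}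
    (hθ : ∀ u p, goPairing b w u (θ p) = goPairing b w (Env.of a * u) p)
    (p q : MvPolynomial ι ℝ) : θ (p * q) = θ p * q + p * θ q := by
  refine goPairing_ext b hw fun u => ?_
  rw [hθ]
  induction u using Env.induction_goStar b generalizing p q with
  | h1 =>
    -- As `a = 1 ⋆ a`, the map `θ` and the genuine derivation `∂_a` agree at the origin, which
    -- settles `u = 1`.
    have h : ∀ r, constantCoeff (dualDeriv b w a r) = constantCoeff (θ r) := fun r => by
      rw [← goPairing_one_left b w, ← goPairing_one_left b w, hθ, mul_one, ← goStar_one,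
        goPairing_goStar]
    rw [mul_one, ← goStar_one, goPairing_goStar, goPairing_one_left, goPairing_one_left,
      Derivation.leibniz]
    simp only [map_add, map_mul, smul_eq_mul, h]
    ring
  | hadd u v hu hv => simp only [mul_add, map_add, LinearMap.add_apply, hu, hv]; abel
  | hsmul r u hu => simp only [mul_smul_comm, map_smul, LinearMap.smul_apply, hu]
  | hstar u i hu =>
    have h : Env.of a * goStar u (b i) = goStar (Env.of a * u) (b i) + goStar u (a * b i) := by
      rw [goStar_of_mul]; abel
    -- The recursion for `⋆`, transposed: `[∂_i, θ] = ∂_(a ▷ b i)`. It reduces the Leibniz defect at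
    -- `u ⋆ b i` to that at `u`, applied to the pairs `(∂_i p, q)` and `(p, ∂_i q)`.
    have hcomm : ∀ r, dualDeriv b w (b i) (θ r) =
        θ (dualDeriv b w (b i) r) + dualDeriv b w (a * b i) r := fun r => by
      refine goPairing_ext b hw fun v => ?_
      rw [map_add, ← goPairing_goStar, hθ, hθ, ← goPairing_goStar, ← goPairing_goStar,
        goStar_of_mul, ← LinearMap.add_apply, ← map_add]
      congr 2
      abel
    rw [h, map_add, LinearMap.add_apply, goPairing_goStar, goPairing_goStar, goPairing_goStar]
    simp only [Derivation.leibniz, smul_eq_mul, map_add, hcomm, mul_add]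
    rw [mul_comm q, hu, hu]
    simp only [map_add]
    rw [mul_comm q (dualDeriv b w (a * b i) p), mul_comm q (θ _), mul_comm (θ q)]
    ring

end Pairing

/-! ### The antipode of the enveloping algebra -/

section Antipode

variable {L : Type*} [LeftPreLieRing L] [LeftPreLieAlgebra ℝ L]

attribute [local instance 100] LieRing.ofAssociativeRing

/-- The antipode of the enveloping algebra, as a morphism to the opposite algebra. -/
def Env.antipodeOp : Env L →ₐ[ℝ] (Env L)ᵐᵒᵖ :=
  UniversalEnvelopingAlgebra.lift ℝ
    { toFun := fun a => MulOpposite.op (-Env.of a)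
      map_add' := fun a c => by simp only [map_add, neg_add, MulOpposite.op_add]
      map_smul' := fun r a => by
        simp only [map_smul, RingHom.id_apply, ← smul_neg, MulOpposite.op_smul]
      map_lie' := fun {a c} => by
        rw [LieHom.map_lie, Ring.lie_def, Ring.lie_def, ← MulOpposite.op_mul,
          ← MulOpposite.op_mul, ← MulOpposite.op_sub, neg_mul_neg, neg_mul_neg, neg_sub] }

/-- The antipode of the enveloping algebra, the anti-automorphism with `a ↦ -a` on `L`. -/
def Env.antipode : Env L →ₗ[ℝ] Env L :=
  (MulOpposite.opLinearEquiv ℝ).symm.toLinearMap ∘ₗ Env.antipodeOp.toLinearMap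

theorem Env.antipode_one : Env.antipode (1 : Env L) = 1 := by
  simp [Env.antipode]

theorem Env.antipode_of (a : L) : Env.antipode (Env.of a) = -Env.of a := by
  simp only [Env.antipode, Env.antipodeOp, LinearMap.comp_apply, AlgHom.toLinearMap_apply,
    UniversalEnvelopingAlgebra.lift_ι_apply]
  rfl

theorem Env.antipode_mul (u v : Env L) :
    Env.antipode (u * v) = Env.antipode v * Env.antipode u := by
  simp [Env.antipode]

theorem Env.antipode_of_mul (a : L) (u : Env L) :
    Env.antipode (Env.of a * u) = -(Env.antipode u * Env.of a) := by
  rw [Env.antipode_mul, Env.antipode_of, mul_neg]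

end Antipode

/-! ### The Hopf algebra dual to an enveloping algebra -/

section DualHopf

variable {L : Type*} [LeftPreLieRing L] [LeftPreLieAlgebra ℝ L] {ι : Type*}

attribute [local instance 100] LieRing.ofAssociativeRing

open MvPolynomial

section TensorLemmas

variable {A N : Type*} [CommRing A] [Algebra ℝ A] [CommRing N] [Algebra ℝ N]

theorem rTensor_leibniz {D : A →ₗ[ℝ] A} (hD : ∀ p q, D (p * q) = D p * q + p * D q)
    (s t : A ⊗[ℝ] N) :
    D.rTensor N (s * t) = D.rTensor N s * t + s * D.rTensor N t := by
  induction s using TensorProduct.induction_on with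
  | zero => simp
  | add s s' hs hs' => simp only [add_mul, map_add, hs, hs']; abel
  | tmul x y =>
    induction t using TensorProduct.induction_on with
    | zero => simp
    | add t t' ht ht' => simp only [mul_add, map_add, ht, ht']; abel
    | tmul z v => simp [hD, TensorProduct.add_tmul]

theorem leftSlice_mul {f : A →ₗ[ℝ] ℝ} (hf : ∀ p q, f (p * q) = f p * f q) (s t : A ⊗[ℝ] N) :
    leftSlice N f (s * t) = leftSlice N f s * leftSlice N f t := by
  induction s using TensorProduct.induction_on with
  | zero => simp
  | add s s' hs hs' => simp only [add_mul, map_add, hs, hs']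
  | tmul x y =>
    induction t using TensorProduct.induction_on with
    | zero => simp
    | add t t' ht ht' => simp only [mul_add, map_add, ht, ht']
    | tmul z v => simp [hf, smul_smul, mul_comm]

/-- Reduces coassociativity to the commutation of `Δ` with the adjoints of left multiplications. -/
theorem leftSlice_assoc_rTensor {M : Type*} [AddCommGroup M] [Module ℝ M]
    (f : A →ₗ[ℝ] ℝ) (Δ : M →ₗ[ℝ] A ⊗[ℝ] A) (t : M ⊗[ℝ] A) :
    leftSlice (A ⊗[ℝ] A) f (TensorProduct.assoc ℝ A A A (Δ.rTensor A t)) =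
      (leftSlice A f ∘ₗ Δ).rTensor A t := by
  induction t using TensorProduct.induction_on with
  | zero => simp
  | add s t hs ht => simp only [map_add, hs, ht]
  | tmul x y =>
    rw [LinearMap.rTensor_tmul, LinearMap.rTensor_tmul, LinearMap.comp_apply]
    induction Δ x using TensorProduct.induction_on with
    | zero => simp
    | add s t hs ht => simp only [TensorProduct.add_tmul, map_add, hs, ht]
    | tmul z v => simp [TensorProduct.smul_tmul']

end TensorLemmas

variable {b : Module.Basis ι ℝ L} {w : ι → ℝ}
  {Δ : MvPolynomial ι ℝ →ₗ[ℝ] MvPolynomial ι ℝ ⊗[ℝ] MvPolynomial ι ℝ}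

/-- The adjoint `(⟨u, ·⟩ ⊗ id) Δ` of the left multiplication by `u`. -/
def mulLeftAdj (b : Module.Basis ι ℝ L) (w : ι → ℝ)
    (Δ : MvPolynomial ι ℝ →ₗ[ℝ] MvPolynomial ι ℝ ⊗[ℝ] MvPolynomial ι ℝ) (u : Env L) :
    MvPolynomial ι ℝ →ₗ[ℝ] MvPolynomial ι ℝ :=
  leftSlice _ (goPairing b w u) ∘ₗ Δ

/-- The adjoint `(id ⊗ ⟨v, ·⟩) Δ` of the right multiplication by `v`. -/
def mulRightAdj (b : Module.Basis ι ℝ L) (w : ι → ℝ)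
    (Δ : MvPolynomial ι ℝ →ₗ[ℝ] MvPolynomial ι ℝ ⊗[ℝ] MvPolynomial ι ℝ) (v : Env L) :
    MvPolynomial ι ℝ →ₗ[ℝ] MvPolynomial ι ℝ :=
  rightSlice _ (goPairing b w v) ∘ₗ Δ

/-- `Δ` is dual to the product of the enveloping algebra. -/
def IsDualComul (b : Module.Basis ι ℝ L) (w : ι → ℝ)
    (Δ : MvPolynomial ι ℝ →ₗ[ℝ] MvPolynomial ι ℝ ⊗[ℝ] MvPolynomial ι ℝ) : Prop :=
  ∀ u v p, goPairing b w v (leftSlice _ (goPairing b w u) (Δ p)) = goPairing b w (u * v) p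

namespace IsDualComul

variable (hΔ : IsDualComul b w Δ)
include hΔ

theorem goPairing_mulLeftAdj (u v : Env L) (p : MvPolynomial ι ℝ) :
    goPairing b w v (mulLeftAdj b w Δ u p) = goPairing b w (u * v) p :=
  hΔ u v p

theorem goPairing_mulRightAdj (u v : Env L) (p : MvPolynomial ι ℝ) :
    goPairing b w u (mulRightAdj b w Δ v p) = goPairing b w (u * v) p := by
  rw [← hΔ, apply_leftSlice]
  rfl

theorem leftSlice_rTensor_mulLeftAdj (u v : Env L) {N : Type*} [AddCommGroup N] [Module ℝ N]
    (t : MvPolynomial ι ℝ ⊗[ℝ] N) :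
    leftSlice N (goPairing b w v) ((mulLeftAdj b w Δ u).rTensor N t) =
      leftSlice N (goPairing b w (u * v)) t := by
  induction t using TensorProduct.induction_on with
  | zero => simp
  | add s t hs ht => simp only [map_add, hs, ht]
  | tmul x y => simp [hΔ.goPairing_mulLeftAdj]

variable (hw : ∀ i, w i ≠ 0)
include hw

theorem mulLeftAdj_one (p : MvPolynomial ι ℝ) : mulLeftAdj b w Δ 1 p = p :=
  goPairing_ext b hw fun v => by rw [hΔ.goPairing_mulLeftAdj, one_mul]

theorem mulRightAdj_one (p : MvPolynomial ι ℝ) : mulRightAdj b w Δ 1 p = p :=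
  goPairing_ext b hw fun v => by rw [hΔ.goPairing_mulRightAdj, mul_one]

theorem mulLeftAdj_leibniz (a : L) (p q : MvPolynomial ι ℝ) :
    mulLeftAdj b w Δ (Env.of a) (p * q) =
      mulLeftAdj b w Δ (Env.of a) p * q + p * mulLeftAdj b w Δ (Env.of a) q :=
  leibniz_of_adjoint_mulLeft b hw (fun _ _ => hΔ.goPairing_mulLeftAdj _ _ _) p q

theorem mulLeftAdj_mul (u v : Env L) (p : MvPolynomial ι ℝ) :
    mulLeftAdj b w Δ (u * v) p = mulLeftAdj b w Δ v (mulLeftAdj b w Δ u p) :=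
  goPairing_ext b hw fun x => by
    rw [hΔ.goPairing_mulLeftAdj, hΔ.goPairing_mulLeftAdj, hΔ.goPairing_mulLeftAdj, mul_assoc]

/-- Associativity, transposed: sliced by `v`, both sides become the adjoint of left multiplication
by `u * v`. This is coassociativity in disguise. -/
theorem comul_mulLeftAdj (u : Env L) (p : MvPolynomial ι ℝ) :
    Δ (mulLeftAdj b w Δ u p) = (mulLeftAdj b w Δ u).rTensor _ (Δ p) :=
  leftSlice_ext b hw fun v => by
    rw [hΔ.leftSlice_rTensor_mulLeftAdj]
    exact (hΔ.mulLeftAdj_mul hw u v p).symm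

theorem comul_mulRightAdj (u : Env L) (p : MvPolynomial ι ℝ) :
    Δ (mulRightAdj b w Δ u p) = (mulRightAdj b w Δ u).lTensor _ (Δ p) :=
  leftSlice_ext b hw fun v => by
    rw [leftSlice_lTensor]
    refine goPairing_ext b hw fun x => ?_
    rw [hΔ.goPairing_mulRightAdj, hΔ, hΔ, hΔ.goPairing_mulRightAdj, mul_assoc]

/-- Both sides are dual to inserting `a` in the middle, `(v, x) ↦ v a x`. -/
theorem rTensor_mulRightAdj (a : Env L) (p : MvPolynomial ι ℝ) :
    (mulRightAdj b w Δ a).rTensor _ (Δ p) = (mulLeftAdj b w Δ a).lTensor _ (Δ p) :=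
  leftSlice_ext b hw fun v => by
    have h : ∀ t : MvPolynomial ι ℝ ⊗[ℝ] MvPolynomial ι ℝ,
        leftSlice _ (goPairing b w v) ((mulRightAdj b w Δ a).rTensor _ t) =
          leftSlice _ (goPairing b w (v * a)) t := fun t => by
      induction t using TensorProduct.induction_on with
      | zero => simp
      | add s t hs ht => simp only [map_add, hs, ht]
      | tmul x y => simp [hΔ.goPairing_mulRightAdj]
    rw [h, leftSlice_lTensor]
    refine goPairing_ext b hw fun x => ?_
    rw [hΔ, hΔ.goPairing_mulLeftAdj, hΔ, mul_assoc]

theorem map_one : Δ 1 = 1 := by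
  refine leftSlice_ext b hw fun u => goPairing_ext b hw fun v => ?_
  rw [hΔ, Algebra.TensorProduct.one_def, leftSlice_tmul, goPairing_mul_one, map_smul, smul_eq_mul]

/-- Slicing by `1` returns the polynomial itself, which starts the induction on the slicing element
`u`. Passing from `u` to `a u` applies `θ_a` to the left factor, and both sides then obey the same
Leibniz rule. -/
theorem map_mul (p q : MvPolynomial ι ℝ) : Δ (p * q) = Δ p * Δ q := by
  refine leftSlice_ext b hw fun u => ?_
  induction u using Env.induction generalizing p q with
  | h1 =>
    rw [leftSlice_mul fun p q => by simp only [goPairing_one_left, _root_.map_mul]]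
    change mulLeftAdj b w Δ 1 (p * q) = mulLeftAdj b w Δ 1 p * mulLeftAdj b w Δ 1 q
    simp only [hΔ.mulLeftAdj_one hw]
  | hadd u v hu hv =>
    have h : ∀ t : MvPolynomial ι ℝ ⊗[ℝ] MvPolynomial ι ℝ,
        leftSlice _ (goPairing b w (u + v)) t =
          leftSlice _ (goPairing b w u) t + leftSlice _ (goPairing b w v) t := fun t => by
      simp [leftSlice, LinearMap.rTensor_add]
    rw [h, h, hu, hv]
  | hsmul r u hu =>
    have h : ∀ t : MvPolynomial ι ℝ ⊗[ℝ] MvPolynomial ι ℝ,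
        leftSlice _ (goPairing b w (r • u)) t = r • leftSlice _ (goPairing b w u) t := fun t => by
      simp [leftSlice, LinearMap.rTensor_smul]
    rw [h, h, hu]
  | hmul a u hu =>
    rw [← hΔ.leftSlice_rTensor_mulLeftAdj, ← hΔ.leftSlice_rTensor_mulLeftAdj,
      rTensor_leibniz (hΔ.mulLeftAdj_leibniz hw a), ← hΔ.comul_mulLeftAdj hw,
      ← hΔ.comul_mulLeftAdj hw, ← hΔ.comul_mulLeftAdj hw, hΔ.mulLeftAdj_leibniz hw a, map_add,
      map_add, map_add, hu, hu]

/-- The dual coproduct as an algebra morphism. -/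
def comulHom : MvPolynomial ι ℝ →ₐ[ℝ] MvPolynomial ι ℝ ⊗[ℝ] MvPolynomial ι ℝ :=
  AlgHom.ofLinearMap Δ (hΔ.map_one hw) (hΔ.map_mul hw)

end IsDualComul

theorem goPairing_one_antipode {S : MvPolynomial ι ℝ →ₗ[ℝ] MvPolynomial ι ℝ}
    (hS : ∀ u p, goPairing b w u (S p) = goPairing b w (Env.antipode u) p)
    (p : MvPolynomial ι ℝ) : goPairing b w 1 (S p) = goPairing b w 1 p := by
  rw [hS, Env.antipode_one]

theorem goPairing_one_left' (p : MvPolynomial ι ℝ) :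
    goPairing b w 1 p = aeval (fun _ => (0 : ℝ)) p := by
  rw [goPairing_one_left, aeval_zero']
  rfl

namespace IsDualComul

variable (hΔ : IsDualComul b w Δ) (hw : ∀ i, w i ≠ 0) {S : MvPolynomial ι ℝ →ₗ[ℝ] MvPolynomial ι ℝ}
  (hS : ∀ u p, goPairing b w u (S p) = goPairing b w (Env.antipode u) p)
include hΔ hw hS

theorem mulLeftAdj_antipode (a : L) (p : MvPolynomial ι ℝ) :
    mulLeftAdj b w Δ (Env.of a) (S p) = -S (mulRightAdj b w Δ (Env.of a) p) :=
  goPairing_ext b hw fun u => by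
    rw [hΔ.goPairing_mulLeftAdj, hS, Env.antipode_of_mul, map_neg, map_neg, LinearMap.neg_apply,
      hS, hΔ.goPairing_mulRightAdj]

/-- By `mulLeftAdj_antipode`, `θ_a` of the convolution product is a difference of two terms in which
`a` is inserted in the middle of the coproduct from either side; they cancel by
`rTensor_mulRightAdj`. Only the pairing with `1` survives. -/
theorem mul_antipode_rTensor (p : MvPolynomial ι ℝ) :
    LinearMap.mul' ℝ _ (S.rTensor _ (Δ p)) = algebraMap ℝ _ (aeval (fun _ => (0 : ℝ)) p) := by
  have hdθ : ∀ (a : L) (t : MvPolynomial ι ℝ ⊗[ℝ] MvPolynomial ι ℝ),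
      mulLeftAdj b w Δ (Env.of a) (LinearMap.mul' ℝ _ (S.rTensor _ t)) =
        LinearMap.mul' ℝ _ (S.rTensor _ ((mulLeftAdj b w Δ (Env.of a)).lTensor _ t)) -
        LinearMap.mul' ℝ _ (S.rTensor _ ((mulRightAdj b w Δ (Env.of a)).rTensor _ t)) := by
    intro a t
    induction t using TensorProduct.induction_on with
    | zero => simp
    | add s t hs ht => simp only [map_add, hs, ht]; abel
    | tmul x y =>
      simp only [LinearMap.rTensor_tmul, LinearMap.lTensor_tmul, LinearMap.mul'_apply,
        hΔ.mulLeftAdj_leibniz hw, hΔ.mulLeftAdj_antipode hw hS]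
      ring
  refine goPairing_ext b hw fun u => ?_
  induction u using Env.induction with
  | hadd u v hu hv => simp only [map_add, LinearMap.add_apply, hu, hv]
  | hsmul r u hu => simp only [map_smul, LinearMap.smul_apply, hu]
  | h1 =>
    have h : ∀ t : MvPolynomial ι ℝ ⊗[ℝ] MvPolynomial ι ℝ,
        goPairing b w 1 (LinearMap.mul' ℝ _ (S.rTensor _ t)) =
          goPairing b w 1 (leftSlice _ (goPairing b w 1) t) := fun t => by
      induction t using TensorProduct.induction_on with
      | zero => simp
      | add s t hs ht => simp only [map_add, hs, ht]
      | tmul x y =>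
        rw [LinearMap.rTensor_tmul, LinearMap.mul'_apply, leftSlice_tmul, map_smul,
          ← goPairing_one_antipode hS x]
        simp only [goPairing_one_left, _root_.map_mul, smul_eq_mul]
    rw [h, hΔ, one_mul, Algebra.algebraMap_eq_smul_one, map_smul, goPairing_one_one,
      goPairing_one_left', smul_eq_mul, mul_one]
  | hmul a u _ =>
    rw [← hΔ.goPairing_mulLeftAdj, hdθ, hΔ.rTensor_mulRightAdj hw, sub_self, map_zero,
      Algebra.algebraMap_eq_smul_one, map_smul, goPairing_of_mul_one, smul_zero]

/-- Here `a` is inserted at the two outer ends, so the terms do not cancel directly. They are the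
same expression for the left and the right adjoint of `a` applied to `p`, so the induction must vary
`p`; both adjoints have constant term `⟨a, p⟩`. -/
theorem mul_antipode_lTensor (p : MvPolynomial ι ℝ) :
    LinearMap.mul' ℝ _ (S.lTensor _ (Δ p)) = algebraMap ℝ _ (aeval (fun _ => (0 : ℝ)) p) := by
  have hdθ : ∀ (a : L) (t : MvPolynomial ι ℝ ⊗[ℝ] MvPolynomial ι ℝ),
      mulLeftAdj b w Δ (Env.of a) (LinearMap.mul' ℝ _ (S.lTensor _ t)) =
        LinearMap.mul' ℝ _ (S.lTensor _ ((mulLeftAdj b w Δ (Env.of a)).rTensor _ t)) -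
        LinearMap.mul' ℝ _ (S.lTensor _ ((mulRightAdj b w Δ (Env.of a)).lTensor _ t)) := by
    intro a t
    induction t using TensorProduct.induction_on with
    | zero => simp
    | add s t hs ht => simp only [map_add, hs, ht]; abel
    | tmul x y =>
      simp only [LinearMap.rTensor_tmul, LinearMap.lTensor_tmul, LinearMap.mul'_apply,
        hΔ.mulLeftAdj_leibniz hw, hΔ.mulLeftAdj_antipode hw hS]
      ring
  refine goPairing_ext b hw fun u => ?_
  induction u using Env.induction generalizing p with
  | hadd u v hu hv => simp only [map_add, LinearMap.add_apply, hu, hv]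
  | hsmul r u hu => simp only [map_smul, LinearMap.smul_apply, hu]
  | h1 =>
    have h : ∀ t : MvPolynomial ι ℝ ⊗[ℝ] MvPolynomial ι ℝ,
        goPairing b w 1 (LinearMap.mul' ℝ _ (S.lTensor _ t)) =
          goPairing b w 1 (leftSlice _ (goPairing b w 1) t) := fun t => by
      induction t using TensorProduct.induction_on with
      | zero => simp
      | add s t hs ht => simp only [map_add, hs, ht]
      | tmul x y =>
        rw [LinearMap.lTensor_tmul, LinearMap.mul'_apply, leftSlice_tmul, map_smul,
          ← goPairing_one_antipode hS y]
        simp only [goPairing_one_left, _root_.map_mul, smul_eq_mul]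
    rw [h, hΔ, one_mul, Algebra.algebraMap_eq_smul_one, map_smul, goPairing_one_one,
      goPairing_one_left', smul_eq_mul, mul_one]
  | hmul a u hu =>
    rw [← hΔ.goPairing_mulLeftAdj, hdθ, ← hΔ.comul_mulLeftAdj hw, ← hΔ.comul_mulRightAdj hw,
      map_sub, hu, hu, ← goPairing_one_left' (b := b) (w := w),
      ← goPairing_one_left' (b := b) (w := w), hΔ.goPairing_mulLeftAdj, hΔ.goPairing_mulRightAdj,
      mul_one, one_mul, sub_self, Algebra.algebraMap_eq_smul_one, map_smul, goPairing_of_mul_one,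
      smul_zero]

/-- The Hopf algebra structure dual to the enveloping algebra. -/
def hopfStructure : HopfStructure (MvPolynomial ι ℝ) where
  comul := hΔ.comulHom hw
  counit := aeval fun _ => 0
  antipode := S
  coassoc := by
    refine AlgHom.ext fun p => leftSlice_ext b hw fun u => ?_
    have h1 := leftSlice_assoc_rTensor (goPairing b w u) Δ (Δ p)
    have h2 := leftSlice_lTensor (goPairing b w u) Δ (Δ p)
    exact h1.trans ((hΔ.comul_mulLeftAdj hw u p).symm.trans h2.symm)
  rTensor_counit_comp_comul := by
    refine AlgHom.ext fun p => (Algebra.TensorProduct.lid ℝ (MvPolynomial ι ℝ)).injective ?_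
    have h : leftSlice _ (goPairing b w 1) (Δ p) = p := hΔ.mulLeftAdj_one hw p
    -- Pairing with the unit of `Env L` is the counit, so the counit law dualizes `1 * v = v`.
    have h' : goPairing b w 1 = (aeval fun _ => (0 : ℝ)).toLinearMap :=
      LinearMap.ext fun p => goPairing_one_left' p
    rw [h'] at h
    refine Eq.trans ?_ (h.trans (AlgEquiv.apply_symm_apply _ p).symm)
    rfl
  lTensor_counit_comp_comul := by
    refine AlgHom.ext fun p => (Algebra.TensorProduct.rid ℝ ℝ (MvPolynomial ι ℝ)).injective ?_
    have h : rightSlice _ (goPairing b w 1) (Δ p) = p := hΔ.mulRightAdj_one hw p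
    have h' : goPairing b w 1 = (aeval fun _ => (0 : ℝ)).toLinearMap :=
      LinearMap.ext fun p => goPairing_one_left' p
    rw [h'] at h
    refine Eq.trans ?_ (h.trans (AlgEquiv.apply_symm_apply _ p).symm)
    rfl
  mul_antipode_rTensor_comul := LinearMap.ext fun p => hΔ.mul_antipode_rTensor hw hS p
  mul_antipode_lTensor_comul := LinearMap.ext fun p => hΔ.mul_antipode_lTensor hw hS p

theorem isTransposeOfMul_hopfStructure :
    IsTransposeOfMul (goPairing b w) (hΔ.hopfStructure hw hS).comul := fun u v p => by
  rw [mul'_map_eq_leftSlice]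
  exact hΔ u v p

end IsDualComul

end DualHopf

/-! ### Gradings, existence of transposes and functoriality -/

section Functoriality

variable {L L' : Type*} [LeftPreLieRing L] [LeftPreLieAlgebra ℝ L]
  [LeftPreLieRing L'] [LeftPreLieAlgebra ℝ L'] {ι ι' : Type*}

attribute [local instance 100] LieRing.ofAssociativeRing

open MvPolynomial

/-- The morphism of enveloping algebras induced by a morphism of pre-Lie algebras. -/
def Env.map (φ : L →ₗ[ℝ] L') (hφ : ∀ x y, φ (x * y) = φ x * φ y) : Env L →ₐ[ℝ] Env L' :=
  UniversalEnvelopingAlgebra.lift ℝ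
    { toFun := fun a => Env.of (φ a)
      map_add' := fun a c => by simp only [map_add]
      map_smul' := fun r a => by simp only [map_smul, RingHom.id_apply]
      map_lie' := fun {a c} => by
        rw [← LieHom.map_lie, Ring.lie_def, Ring.lie_def, map_sub, hφ, hφ] }

section Map

variable {φ : L →ₗ[ℝ] L'} (hφ : ∀ x y, φ (x * y) = φ x * φ y)

theorem Env.map_of (a : L) : Env.map φ hφ (Env.of a) = Env.of (φ a) := by
  rw [Env.map, UniversalEnvelopingAlgebra.lift_ι_apply]
  rfl

theorem Env.map_of_mul (a : L) (u : Env L) :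
    Env.map φ hφ (Env.of a * u) = Env.of (φ a) * Env.map φ hφ u := by
  rw [map_mul, Env.map_of]

theorem Env.map_goStar (u : Env L) (a : L) :
    Env.map φ hφ (goStar u a) = goStar (Env.map φ hφ u) (φ a) := by
  induction u using Env.induction generalizing a with
  | h1 => rw [goStar_one, map_one, goStar_one, Env.map_of]
  | hadd u v hu hv => rw [goStar_add, map_add, hu, hv, map_add, goStar_add]
  | hsmul r u hu => rw [goStar_smul, map_smul, hu, map_smul, goStar_smul]
  | hmul c u hu =>
    rw [goStar_of_mul, map_sub, Env.map_of_mul, hu, hu, Env.map_of_mul, goStar_of_mul, hφ]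

theorem Env.map_antipode (u : Env L) :
    Env.map φ hφ (Env.antipode u) = Env.antipode (Env.map φ hφ u) := by
  induction u using Env.induction with
  | h1 => rw [Env.antipode_one, map_one, Env.antipode_one]
  | hadd u v hu hv => simp only [map_add, hu, hv]
  | hsmul r u hu => simp only [map_smul, hu]
  | hmul c u hu =>
    rw [Env.antipode_of_mul, map_neg, map_mul, hu, Env.map_of_mul, Env.map_of, Env.antipode_of_mul]

end Map

/-- The linear map multiplying the basis vector `b i` by `2 ^ deg i`. -/
def gradingScale (b : Module.Basis ι ℝ L) (deg : ι → ℕ) : L →ₗ[ℝ] L :=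
  b.constr ℝ fun i => (2 : ℝ) ^ deg i • b i

theorem gradingScale_basis (b : Module.Basis ι ℝ L) (deg : ι → ℕ) (i : ι) :
    gradingScale b deg (b i) = (2 : ℝ) ^ deg i • b i := by
  rw [gradingScale, Module.Basis.constr_basis]

/-- A connected grading of finite type of a pre-Lie algebra for which `b` is homogeneous; the
compatibility with the product is expressed by the associated scaling. -/
structure IsPreLieGrading (b : Module.Basis ι ℝ L) (deg : ι → ℕ) : Prop where
  pos : ∀ i, deg i ≠ 0
  finite : ∀ n, {i | deg i ≤ n}.Finite
  mul : ∀ x y, gradingScale b deg (x * y) = gradingScale b deg x * gradingScale b deg y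

namespace IsPreLieGrading

variable {b : Module.Basis ι ℝ L} {deg : ι → ℕ} (hd : IsPreLieGrading b deg)
include hd

/-- The scaling automorphism of the enveloping algebra. -/
def scale : Env L →ₐ[ℝ] Env L := Env.map (gradingScale b deg) hd.mul

theorem scale_goProd (s : Multiset ι) :
    hd.scale (goProd b s) = (2 : ℝ) ^ (s.map deg).sum • goProd b s := by
  induction s using Multiset.induction with
  | empty => simp [goProd_zero]
  | cons i s ih =>
    rw [goProd_cons]
    refine (Env.map_goStar hd.mul _ _).trans ?_
    change goStar (hd.scale _) _ = _
    rw [ih, gradingScale_basis, map_smul, goStar_smul, smul_smul, Multiset.map_cons,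
      Multiset.sum_cons, pow_add]

theorem scale_goElem (I : ι →₀ ℕ) :
    hd.scale (goElem b I) = (2 : ℝ) ^ Finsupp.weight deg I • goElem b I := by
  rw [goElem, map_smul, hd.scale_goProd, smul_comm, Finsupp.toMultiset_map, Finsupp.weight_apply,
    Finsupp.sum_toMultiset,
    Finsupp.sum_mapDomain_index (by simp) (by simp [add_mul])]

theorem goPairing_scale (w : ι → ℝ) (u : Env L) (K : ι →₀ ℕ) :
    goPairing b w (hd.scale u) (monomial K 1) =
      2 ^ Finsupp.weight deg K * goPairing b w u (monomial K 1) := by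
  classical
  have h : (goPairing b w).flip (monomial K 1) ∘ₗ hd.scale.toLinearMap =
      (2 : ℝ) ^ Finsupp.weight deg K • (goPairing b w).flip (monomial K 1) := by
    refine (goBasis b).ext fun I => ?_
    simp only [goBasis_apply, LinearMap.comp_apply, AlgHom.toLinearMap_apply, hd.scale_goElem,
      LinearMap.flip_apply, map_smul, LinearMap.smul_apply, goPairing_goElem, coeff_monomial]
    split_ifs with hKI
    · rw [hKI]
    · simp
  exact LinearMap.congr_fun h u

/-- Homogeneity is tested by scaling: distinct degrees give distinct powers of `2`, so an element
scaled by `2 ^ n` pairs only with monomials of weight `n`. -/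
theorem weight_eq {w : ι → ℝ} {u : Env L} {K : ι →₀ ℕ} {n : ℕ}
    (hu : hd.scale u = (2 : ℝ) ^ n • u) (hne : goPairing b w u (monomial K 1) ≠ 0) :
    n = Finsupp.weight deg K := by
  have h := hd.goPairing_scale w u K
  rw [hu, map_smul, LinearMap.smul_apply, smul_eq_mul] at h
  exact pow_right_injective₀ (by norm_num) (by norm_num) (mul_right_cancel₀ hne h)

theorem finite_weight_le (n : ℕ) : {I : ι →₀ ℕ | Finsupp.weight deg I ≤ n}.Finite :=
  _root_.finite_weight_le hd.pos (hd.finite n)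

variable {w : ι → ℝ} (hw : ∀ i, w i ≠ 0)
include hw

/-- Scaling is an algebra morphism, so `A_I A_J` can pair with the monomial `K` only when the
weights of `I` and `J` add up to that of `K`; this leaves finitely many pairs. -/
theorem exists_isDualComul : ∃ Δ, IsDualComul b w Δ := by
  classical
  let P2 : Env L ⊗[ℝ] Env L →ₗ[ℝ] MvPolynomial ι ℝ ⊗[ℝ] MvPolynomial ι ℝ →ₗ[ℝ] ℝ :=
    TensorProduct.dualDistrib ℝ _ _ ∘ₗ TensorProduct.map (goPairing b w) (goPairing b w)
  have hP2 : ∀ I J K M, P2 (goElem b I ⊗ₜ goElem b J) (monomial K 1 ⊗ₜ monomial M 1) =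
      ((I.prod fun i n => w i ^ n) * coeff I (monomial K 1)) *
        ((J.prod fun i n => w i ^ n) * coeff J (monomial M 1)) := fun I J K M => by
    simp [P2, goPairing_goElem]
  obtain ⟨Δ, hΔ⟩ := exists_transpose ((goBasis b).tensorProduct (goBasis b))
    ((basisMonomials ι ℝ).tensorProduct (basisMonomials ι ℝ)) (basisMonomials ι ℝ) P2
    (by
      rintro ⟨I, J⟩
      rw [Module.Basis.tensorProduct_apply, Module.Basis.tensorProduct_apply, goBasis_apply,
        goBasis_apply, coe_basisMonomials, hP2]
      simp [prod_weight_ne_zero hw])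
    (by
      rintro ⟨I, J⟩ ⟨K, M⟩ hne
      rw [Module.Basis.tensorProduct_apply, Module.Basis.tensorProduct_apply, goBasis_apply,
        goBasis_apply, coe_basisMonomials, hP2, coeff_monomial, coeff_monomial]
      split_ifs with h1 h2
      · exact absurd (by rw [h1, h2]) hne
      all_goals simp)
    (goPairing b w ∘ₗ LinearMap.mul' ℝ (Env L)) (fun K => by
      refine ((hd.finite_weight_le (Finsupp.weight deg K)).prod
        (hd.finite_weight_le (Finsupp.weight deg K))).subset ?_
      rintro ⟨I, J⟩ hne
      rw [Set.mem_ofPred_eq, Module.Basis.tensorProduct_apply, goBasis_apply, goBasis_apply,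
        LinearMap.comp_apply, LinearMap.mul'_apply, coe_basisMonomials] at hne
      have := hd.weight_eq (n := Finsupp.weight deg I + Finsupp.weight deg J) (by
        rw [map_mul, hd.scale_goElem, hd.scale_goElem, smul_mul_smul_comm, pow_add]) hne
      simp only [Set.mem_prod, Set.mem_ofPred_eq]
      omega)
  refine ⟨Δ, fun u v p => ?_⟩
  have h : P2 (u ⊗ₜ v) (Δ p) = goPairing b w (u * v) p := hΔ (u ⊗ₜ v) p
  rw [← h]
  induction Δ p using TensorProduct.induction_on with
  | zero => simp
  | add s t hs ht => simp only [map_add, hs, ht]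
  | tmul x y => simp [P2]

variable {b' : Module.Basis ι' ℝ L'} {deg' : ι' → ℕ} (hd' : IsPreLieGrading b' deg')
include hd'

/-- Commuting with the scalings means preserving degrees, which gives the finiteness needed by
`exists_transpose`. It serves both the antipode and the lift of `Ψ`. -/
theorem exists_adjoint (w' : ι' → ℝ) (f : Env L →ₗ[ℝ] Env L')
    (hf : ∀ u, hd'.scale (f u) = f (hd.scale u)) :
    ∃ T : MvPolynomial ι' ℝ →ₗ[ℝ] MvPolynomial ι ℝ,
      ∀ u p, goPairing b w u (T p) = goPairing b' w' (f u) p := by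
  classical
  refine exists_transpose (goBasis b) (basisMonomials ι ℝ) (basisMonomials ι' ℝ) (goPairing b w)
    (fun I => ?_) (fun I J hIJ => ?_) (goPairing b' w' ∘ₗ f) fun K => ?_
  · rw [goBasis_apply, goPairing_goElem, coe_basisMonomials, coeff_monomial, if_pos rfl, mul_one]
    exact prod_weight_ne_zero hw I
  · rw [goBasis_apply, goPairing_goElem, coe_basisMonomials, coeff_monomial, if_neg hIJ.symm,
      mul_zero]
  · refine (hd.finite_weight_le (Finsupp.weight deg' K)).subset fun I hne => ?_
    rw [Set.mem_ofPred_eq, goBasis_apply, LinearMap.comp_apply, coe_basisMonomials] at hne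
    exact (hd'.weight_eq (by rw [hf, hd.scale_goElem, map_smul]) hne).le

end IsPreLieGrading

theorem IsPreLieGrading.exists_antipode {b : Module.Basis ι ℝ L} {deg : ι → ℕ}
    (hd : IsPreLieGrading b deg) {w : ι → ℝ} (hw : ∀ i, w i ≠ 0) :
    ∃ S : MvPolynomial ι ℝ →ₗ[ℝ] MvPolynomial ι ℝ,
      ∀ u p, goPairing b w u (S p) = goPairing b w (Env.antipode u) p :=
  hd.exists_adjoint hw hd w Env.antipode fun u => Env.map_antipode hd.mul u

section Transposed

variable {b : Module.Basis ι ℝ L} {b' : Module.Basis ι' ℝ L'} {w : ι → ℝ} {w' : ι' → ℝ}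
  {Δ : MvPolynomial ι ℝ →ₗ[ℝ] MvPolynomial ι ℝ ⊗[ℝ] MvPolynomial ι ℝ}
  {Δ' : MvPolynomial ι' ℝ →ₗ[ℝ] MvPolynomial ι' ℝ ⊗[ℝ] MvPolynomial ι' ℝ}
  (hΔ : IsDualComul b w Δ) (hΔ' : IsDualComul b' w' Δ')
  (hw : ∀ i, w i ≠ 0) (hw' : ∀ i, w' i ≠ 0)
  {φ : L →ₗ[ℝ] L'} (hφ : ∀ x y, φ (x * y) = φ x * φ y)
  {T : MvPolynomial ι' ℝ →ₗ[ℝ] MvPolynomial ι ℝ}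
  (hT : ∀ u p, goPairing b w u (T p) = goPairing b' w' (Env.map φ hφ u) p)

theorem goPairing_map_one (u : Env L) :
    goPairing b' w' (Env.map φ hφ u) 1 = goPairing b w u 1 := by
  induction u using Env.induction with
  | h1 => rw [map_one (Env.map φ hφ), goPairing_one_one, goPairing_one_one]
  | hadd u v hu hv => simp only [map_add, LinearMap.add_apply, hu, hv]
  | hsmul r u hu => simp only [map_smul, LinearMap.smul_apply, hu]
  | hmul a u _ => rw [Env.map_of_mul, goPairing_of_mul_one, goPairing_of_mul_one]

include hw hT in
theorem transpose_map_one : T 1 = 1 :=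
  goPairing_ext b hw fun u => by rw [hT, goPairing_map_one hφ]

include hΔ hΔ' hw hw' hT in
-- `T` intertwines the derivations `θ_(φ a)` and `θ_a`, so induction on left factors works as for
-- `IsDualComul.map_mul`.
theorem transpose_map_mul (p q : MvPolynomial ι' ℝ) : T (p * q) = T p * T q := by
  have hθ : ∀ a r, T (mulLeftAdj b' w' Δ' (Env.of (φ a)) r) =
      mulLeftAdj b w Δ (Env.of a) (T r) := fun a r => goPairing_ext b hw fun u => by
    rw [hT, hΔ'.goPairing_mulLeftAdj, hΔ.goPairing_mulLeftAdj, hT, Env.map_of_mul]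
  refine goPairing_ext b hw fun u => ?_
  induction u using Env.induction generalizing p q with
  | h1 =>
    have h : ∀ r, constantCoeff (T r) = constantCoeff r := fun r => by
      rw [← goPairing_one_left b w, hT, map_one, goPairing_one_left]
    simp only [goPairing_one_left, map_mul, h]
  | hadd u v hu hv => simp only [map_add, LinearMap.add_apply, hu, hv]
  | hsmul r u hu => simp only [map_smul, LinearMap.smul_apply, hu]
  | hmul a u hu =>
    rw [← hΔ.goPairing_mulLeftAdj, ← hΔ.goPairing_mulLeftAdj, ← hθ,
      hΔ'.mulLeftAdj_leibniz hw', hΔ.mulLeftAdj_leibniz hw, map_add, map_add, map_add, hu, hu, hθ,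
      hθ]

variable {S : MvPolynomial ι ℝ →ₗ[ℝ] MvPolynomial ι ℝ}
  (hS : ∀ u p, goPairing b w u (S p) = goPairing b w (Env.antipode u) p)
  {S' : MvPolynomial ι' ℝ →ₗ[ℝ] MvPolynomial ι' ℝ}
  (hS' : ∀ u p, goPairing b' w' u (S' p) = goPairing b' w' (Env.antipode u) p)

/-- The transpose of the morphism of enveloping algebras induced by a pre-Lie morphism. -/
def transposeHom : MvPolynomial ι' ℝ →ₐ[ℝ] MvPolynomial ι ℝ :=
  AlgHom.ofLinearMap T (transpose_map_one hw hφ hT) (transpose_map_mul hΔ hΔ' hw hw' hφ hT)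

/-- The three compatibilities dualize that `Env.map` respects products, the unit and the antipode.
-/
theorem isHom_transposeHom : (hΔ'.hopfStructure hw' hS').IsHom (hΔ.hopfStructure hw hS)
    (transposeHom hΔ hΔ' hw hw' hφ hT) where
  comul := by
    refine AlgHom.ext fun p => leftSlice_ext b hw fun u => goPairing_ext b hw fun v => ?_
    have h : ∀ t : MvPolynomial ι' ℝ ⊗[ℝ] MvPolynomial ι' ℝ,
        goPairing b w v (leftSlice _ (goPairing b w u) (TensorProduct.map T T t)) =
          goPairing b' w' (Env.map φ hφ v) (leftSlice _ (goPairing b' w' (Env.map φ hφ u)) t) :=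
      fun t => by
        induction t using TensorProduct.induction_on with
        | zero => simp
        | add s t hs ht => simp only [map_add, hs, ht]
        | tmul x y => simp [hT]
    refine (hΔ u v (T p)).trans (Eq.trans ?_ (h (Δ' p)).symm)
    rw [hT, hΔ', map_mul]
  counit := by
    refine AlgHom.ext fun p => ?_
    change aeval (fun _ => (0 : ℝ)) (T p) = aeval (fun _ => (0 : ℝ)) p
    rw [← goPairing_one_left' (b := b) (w := w), hT, map_one, goPairing_one_left']
  antipode p := by
    change S (T p) = T (S' p)
    exact goPairing_ext b hw fun u => by rw [hS, hT, hT, hS', Env.map_antipode]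

end Transposed

end Functoriality

/-! ### `Ψ` is a pre-Lie morphism -/

section PsiMorphism

open MvPolynomial

variable {𝔏 : Type*}

/-- The normalized monomial `∏ (k!) ^ β(l,k) z^β`. -/
def normMonomial (β : 𝔏 × ℕ →₀ ℕ) : MvPolynomial (𝔏 × ℕ) ℝ :=
  monomial β (β.prod fun x n => (x.2.factorial : ℝ) ^ n)

theorem normMonomial_zero : normMonomial (0 : 𝔏 × ℕ →₀ ℕ) = 1 := by
  simp [normMonomial]

theorem normMonomial_add (β γ : 𝔏 × ℕ →₀ ℕ) :
    normMonomial (β + γ) = normMonomial β * normMonomial γ := by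
  classical
  rw [normMonomial, normMonomial, normMonomial, monomial_mul,
    Finsupp.prod_add_index' (by simp) (by simp [pow_add])]

theorem normMonomial_single (l : 𝔏) (k : ℕ) :
    normMonomial (Finsupp.single (l, k) 1) = C (k.factorial : ℝ) * X (l, k) := by
  rw [normMonomial, Finsupp.prod_single_index (by simp), pow_one, X, C_mul_monomial, mul_one]

theorem normMonomial_sum (m : Multiset (𝔏 × ℕ →₀ ℕ)) :
    normMonomial m.sum = (m.map normMonomial).prod := by
  induction m using Multiset.induction with
  | empty => simp [normMonomial_zero]
  | cons β m ih => rw [Multiset.sum_cons, normMonomial_add, ih, Multiset.map_cons,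
      Multiset.prod_cons]

/-- The normalization by `k!` absorbs the coefficient `k + 1` of `D`: differentiating a node's
factor is giving that node one more child. -/
theorem shiftD_normMonomial_single (l : 𝔏) (k : ℕ) :
    shiftD 𝔏 (normMonomial (Finsupp.single (l, k) 1)) =
      normMonomial (Finsupp.single (l, k + 1) 1) := by
  rw [normMonomial_single, normMonomial_single, ← smul_eq_C_mul, Derivation.map_smul, shiftD,
    mkDerivation_X, smul_smul, smul_eq_C_mul, Nat.factorial_succ]
  push_cast
  rw [mul_comm ((k : ℝ) + 1)]

/-- The Leibniz rule, written with `erase` to match the recursion for grafting. -/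
theorem derivation_prod_map_erase {A α : Type*} [CommRing A] [Algebra ℝ A] [DecidableEq α]
    (D : Derivation ℝ A A) (q : α → A) (m : Multiset α) :
    D (m.map q).prod = (m.map fun t => D (q t) * ((m.erase t).map q).prod).sum := by
  induction m using Multiset.induction with
  | empty => simp
  | cons t m ih =>
    have h : (m.map fun u => D (q u) * (((t ::ₘ m).erase u).map q).prod) =
        m.map fun u => q t * (D (q u) * ((m.erase u).map q).prod) :=
      Multiset.map_congr rfl fun u hu => by
        rw [Multiset.erase_cons_tail_of_mem hu, Multiset.map_cons, Multiset.prod_cons]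
        ring
    rw [Multiset.map_cons, Multiset.prod_cons, Derivation.leibniz, ih, Multiset.map_cons,
      Multiset.sum_cons, Multiset.erase_cons_head, h, Multiset.sum_map_mul_left]
    simp only [smul_eq_mul]
    ring

/-- `Ψ` with values in the full polynomial algebra. -/
def psiPoly (𝔏 : Type*) : TreeSpace 𝔏 →ₗ[ℝ] MvPolynomial (𝔏 × ℕ) ℝ :=
  Submodule.subtype _ ∘ₗ psi 𝔏

theorem psi_treeBasis (τ : DecTree 𝔏) : psi 𝔏 (treeBasis 𝔏 τ) =
    (τ.fertility.prod fun x n => (x.2.factorial : ℝ) ^ n) •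
      zBasis 𝔏 ⟨τ.fertility, τ.bracket_fertility⟩ := by
  rw [psi, Module.Basis.constr_basis]

theorem psiPoly_treeBasis (τ : DecTree 𝔏) :
    psiPoly 𝔏 (treeBasis 𝔏 τ) = normMonomial τ.fertility := by
  rw [psiPoly, LinearMap.comp_apply, psi_treeBasis, map_smul, Submodule.subtype_apply,
    zBasis_apply, smul_monomial, smul_eq_mul, mul_one, normMonomial]

theorem psiPoly_node (l : 𝔏) (m : Multiset (DecTree 𝔏)) :
    psiPoly 𝔏 (treeBasis 𝔏 (DecTree.node l m)) =
      normMonomial (Finsupp.single (l, Multiset.card m) 1) *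
        (m.map fun t => psiPoly 𝔏 (treeBasis 𝔏 t)).prod := by
  simp only [psiPoly_treeBasis, DecTree.fertility_node, normMonomial_add, normMonomial_sum,
    Multiset.map_map, Function.comp_def]

theorem psiPoly_attachTo (l : 𝔏) (m : Multiset (DecTree 𝔏)) (x : TreeSpace 𝔏) :
    psiPoly 𝔏 (TreeSpace.attachTo l m x) =
      normMonomial (Finsupp.single (l, Multiset.card m + 1) 1) *
        (psiPoly 𝔏 x * (m.map fun t => psiPoly 𝔏 (treeBasis 𝔏 t)).prod) := by
  induction x using TreeSpace.basis_induction with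
  | zero => simp
  | add x y hx hy => simp only [map_add, hx, hy, add_mul, mul_add]
  | smul r x hx => simp only [map_smul, hx, smul_mul_assoc, mul_smul_comm]
  | basis τ => rw [TreeSpace.attachTo, Module.Basis.constr_basis, psiPoly_node, Multiset.card_cons,
      Multiset.map_cons, Multiset.prod_cons]

/-- `Ψ` of a tree is its root factor times the product over its subtrees. `D` on the root factor
gives grafting at the root, and `D` on a subtree factor gives grafting inside that subtree. -/
theorem psiPoly_graft (a τ : DecTree 𝔏) : psiPoly 𝔏 (DecTree.graft a τ) =
    psiPoly 𝔏 (treeBasis 𝔏 a) * shiftD 𝔏 (psiPoly 𝔏 (treeBasis 𝔏 τ)) := by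
  classical
  induction τ using DecTree.ind with
  | h l m ih =>
    have h : (m.map fun t => psiPoly 𝔏 (TreeSpace.attachTo l (m.erase t) (DecTree.graft a t))) =
        m.map fun t => (psiPoly 𝔏 (treeBasis 𝔏 a) *
          normMonomial (Finsupp.single (l, Multiset.card m) 1)) *
            (shiftD 𝔏 (psiPoly 𝔏 (treeBasis 𝔏 t)) *
              ((m.erase t).map fun s => psiPoly 𝔏 (treeBasis 𝔏 s)).prod) :=
      Multiset.map_congr rfl fun t ht => by
        -- Replacing one subtree leaves the number of children of the root, hence the root factor,
        -- unchanged.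
        rw [psiPoly_attachTo, ih t ht, Multiset.card_erase_add_one ht]
        ring
    rw [DecTree.graft_node, map_add, map_multiset_sum, Multiset.map_map]
    simp only [Function.comp_def]
    rw [h, Multiset.sum_map_mul_left, psiPoly_node, psiPoly_node, Derivation.leibniz,
      derivation_prod_map_erase, shiftD_normMonomial_single, Multiset.card_cons, Multiset.map_cons,
      Multiset.prod_cons]
    simp only [smul_eq_mul]
    ring

theorem psi_mul (x y : TreeSpace 𝔏) : psi 𝔏 (x * y) = psi 𝔏 x * psi 𝔏 y := by
  refine Subtype.ext ?_
  rw [MultiIndexSpace.coe_mul]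
  change psiPoly 𝔏 (x * y) = psiPoly 𝔏 x * shiftD 𝔏 (psiPoly 𝔏 y)
  induction x using TreeSpace.basis_induction with
  | zero => simp
  | add x x' hx hx' => simp only [add_mul, map_add, hx, hx']
  | smul r x hx => simp only [smul_mul_assoc, map_smul, hx]
  | basis a =>
    induction y using TreeSpace.basis_induction with
    | zero => simp
    | add y y' hy hy' => simp only [mul_add, map_add, hy, hy']
    | smul r y hy => simp only [mul_smul_comm, map_smul, hy, Derivation.map_smul]
    | basis τ => rw [TreeSpace.treeBasis_mul, psiPoly_graft]

end PsiMorphism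

/-! ### The gradings by number of nodes and by total degree -/

section Gradings

open MvPolynomial

variable {𝔏 : Type*}

/-- From `(k + 1) + (1 - k) = 2`. For populated multi-indices the total degree thus controls the
weight `∑ (k + 1) β(l,k)`, which bounds `k`; the degree alone would leave infinitely many variables.
-/
theorem weight_add_bracket (β : 𝔏 × ℕ →₀ ℕ) :
    (Finsupp.weight (fun x : 𝔏 × ℕ => x.2 + 1) β : ℤ) + bracket β = 2 * β.degree := by
  rw [Finsupp.weight_apply, bracket, Finsupp.degree_apply, Finsupp.sum, Finsupp.sum, Nat.cast_sum,
    Nat.cast_sum, ← Finset.sum_add_distrib, Finset.mul_sum]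
  refine Finset.sum_congr rfl fun x _ => ?_
  rw [smul_eq_mul]
  push_cast
  ring

theorem finite_populated_degree_le [Finite 𝔏] (n : ℕ) :
    {β : Populated 𝔏 | β.1.degree ≤ n}.Finite := by
  have h : {x : 𝔏 × ℕ | x.2 + 1 ≤ 2 * n}.Finite :=
    ((Set.finite_univ (α := 𝔏)).prod (Set.finite_le_nat (2 * n))).subset fun x hx => by
      simp only [Set.mem_ofPred_eq, Set.mem_prod, Set.mem_univ, true_and] at hx ⊢
      omega
  refine ((finite_weight_le (d := fun x : 𝔏 × ℕ => x.2 + 1) (fun _ => Nat.succ_ne_zero _) h).preimage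
    Subtype.val_injective.injOn).subset fun β hβ => ?_
  have := weight_add_bracket β.1
  rw [β.2] at this
  simp only [Set.mem_ofPred_eq, Set.mem_preimage] at hβ ⊢
  omega

/-- The algebra endomorphism multiplying every variable by `2`. -/
def doubleVars (𝔏 : Type*) : MvPolynomial (𝔏 × ℕ) ℝ →ₐ[ℝ] MvPolynomial (𝔏 × ℕ) ℝ :=
  aeval fun x => (2 : ℝ) • X x

/-- `D` trades one variable for another, so it preserves the total degree. -/
theorem shiftD_doubleVars (p : MvPolynomial (𝔏 × ℕ) ℝ) :
    shiftD 𝔏 (doubleVars 𝔏 p) = doubleVars 𝔏 (shiftD 𝔏 p) := by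
  induction p using MvPolynomial.induction_on with
  | C r => simp [doubleVars]
  | add p q hp hq => simp only [map_add, hp, hq]
  | mul_X p x hp =>
    have hX : ∀ y, doubleVars 𝔏 (X y) = (2 : ℝ) • X y := fun y => by simp [doubleVars]
    have hD : ∀ y, shiftD 𝔏 (X y) = ((y.2 : ℝ) + 1) • X (y.1, y.2 + 1) := fun y => by
      simp [shiftD]
    simp only [map_mul, map_add, Derivation.leibniz, hX, hD, Derivation.map_smul, hp, smul_eq_mul,
      map_smul, mul_smul_comm, smul_mul_assoc, smul_add]
    rw [smul_comm (2 : ℝ)]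

theorem gradingScale_zBasis (x : MultiIndexSpace 𝔏) :
    (gradingScale (zBasis 𝔏) (fun β => β.1.degree) x).1 = doubleVars 𝔏 x.1 := by
  suffices h : Submodule.subtype _ ∘ₗ gradingScale (zBasis 𝔏) (fun β => β.1.degree) =
      (doubleVars 𝔏).toLinearMap ∘ₗ Submodule.subtype _ from LinearMap.congr_fun h x
  refine (zBasis 𝔏).ext fun β => ?_
  rw [LinearMap.comp_apply, LinearMap.comp_apply, gradingScale_basis, map_smul,
    Submodule.subtype_apply, zBasis_apply, AlgHom.toLinearMap_apply, doubleVars, aeval_monomial,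
    monomial_eq, C_1, one_mul, _root_.map_one, one_mul, Finsupp.prod, Finsupp.prod]
  simp only [smul_pow, Finset.prod_smul, Finset.prod_pow_eq_pow_sum, Finsupp.degree_apply]

theorem isPreLieGrading_zBasis [Finite 𝔏] :
    IsPreLieGrading (zBasis 𝔏) fun β => β.1.degree where
  pos β h := by
    have h0 : β.1 = 0 := (Finsupp.degree_eq_zero_iff _).mp h
    have := β.2
    rw [h0] at this
    simp [bracket] at this
  finite n := finite_populated_degree_le n
  mul x y := Subtype.ext <| by
    rw [gradingScale_zBasis, MultiIndexSpace.coe_mul, MultiIndexSpace.coe_mul, gradingScale_zBasis,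
      gradingScale_zBasis, map_mul, shiftD_doubleVars]

namespace DecTree

theorem numNodes_node (l : 𝔏) (m : Multiset (DecTree 𝔏)) :
    (node l m).numNodes = 1 + (m.map numNodes).sum := by
  rw [numNodes_eq, children_node]

theorem numNodes_ne_zero (τ : DecTree 𝔏) : τ.numNodes ≠ 0 := by
  rw [numNodes_eq]
  omega

theorem degree_fertility (τ : DecTree 𝔏) : τ.fertility.degree = τ.numNodes := by
  induction τ using DecTree.ind with
  | h l m ih =>
    rw [fertility_node, numNodes_node, map_add, Finsupp.degree_single, map_multiset_sum,
      Multiset.map_map, Multiset.map_congr rfl fun t ht => (Function.comp_apply.trans (ih t ht))]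

/-- A tree with at most `n + 1` nodes is a root decoration together with a forest of at most `n`
nodes, and `finite_weight_le` counts such forests. -/
theorem finite_numNodes_le [Finite 𝔏] (n : ℕ) : {τ : DecTree 𝔏 | τ.numNodes ≤ n}.Finite := by
  classical
  induction n with
  | zero =>
    refine Set.Finite.subset Set.finite_empty fun τ hτ => ?_
    exact numNodes_ne_zero τ (Nat.le_zero.mp hτ)
  | succ n ih =>
    refine (((Set.finite_univ (α := 𝔏)).prod (finite_weight_le numNodes_ne_zero ih)).image
      fun x => node x.1 (Finsupp.toMultiset x.2)).subset fun τ hτ => ?_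
    refine ⟨(τ.root, Multiset.toFinsupp τ.children), ⟨trivial, ?_⟩, ?_⟩
    · have h : Finsupp.weight numNodes (Multiset.toFinsupp τ.children) =
          (τ.children.map numNodes).sum := by
        conv_rhs => rw [← Multiset.toFinsupp_toMultiset τ.children]
        rw [Finsupp.toMultiset_map, Finsupp.sum_toMultiset,
          Finsupp.sum_mapDomain_index (by simp) (by simp [add_mul])]
        rfl
      simp only [Set.mem_ofPred_eq] at hτ ⊢
      rw [numNodes_eq] at hτ
      omega
    · simp

end DecTree

theorem gradingScale_attachTo (l : 𝔏) (m : Multiset (DecTree 𝔏)) (x : TreeSpace 𝔏) :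
    gradingScale (treeBasis 𝔏) DecTree.numNodes (TreeSpace.attachTo l m x) =
      (2 : ℝ) ^ (1 + (m.map DecTree.numNodes).sum) •
        TreeSpace.attachTo l m (gradingScale (treeBasis 𝔏) DecTree.numNodes x) := by
  induction x using TreeSpace.basis_induction with
  | zero => simp
  | add x y hx hy => simp only [map_add, hx, hy, smul_add]
  | smul r x hx => simp only [map_smul, hx, smul_comm r]
  | basis τ =>
    rw [gradingScale_basis, map_smul, TreeSpace.attachTo, Module.Basis.constr_basis,
      gradingScale_basis, DecTree.numNodes_node, Multiset.map_cons, Multiset.sum_cons, smul_smul,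
      ← pow_add]
    congr 2
    omega

theorem gradingScale_graft (a τ : DecTree 𝔏) :
    gradingScale (treeBasis 𝔏) DecTree.numNodes (DecTree.graft a τ) =
      (2 : ℝ) ^ (a.numNodes + τ.numNodes) • DecTree.graft a τ := by
  classical
  induction τ using DecTree.ind with
  | h l m ih =>
    have h : (m.map fun t => gradingScale (treeBasis 𝔏) DecTree.numNodes
          (TreeSpace.attachTo l (m.erase t) (DecTree.graft a t))) =
        m.map fun t => (2 : ℝ) ^ (a.numNodes + (DecTree.node l m).numNodes) •
          TreeSpace.attachTo l (m.erase t) (DecTree.graft a t) :=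
      Multiset.map_congr rfl fun t ht => by
        rw [gradingScale_attachTo, ih t ht, map_smul, smul_smul, ← pow_add, DecTree.numNodes_node,
          ← Multiset.sum_map_erase ht]
        congr 2
        omega
    rw [DecTree.graft_node, map_add, map_multiset_sum, Multiset.map_map, gradingScale_basis]
    simp only [Function.comp_def]
    rw [h, smul_add, Multiset.smul_sum, Multiset.map_map]
    simp only [Function.comp_def]
    congr 3
    simp only [DecTree.numNodes_node, Multiset.map_cons, Multiset.sum_cons]
    omega

theorem isPreLieGrading_treeBasis [Finite 𝔏] :
    IsPreLieGrading (treeBasis 𝔏) DecTree.numNodes where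
  pos := DecTree.numNodes_ne_zero
  finite := DecTree.finite_numNodes_le
  mul x y := by
    induction x using TreeSpace.basis_induction with
    | zero => simp
    | add x x' hx hx' => simp only [add_mul, map_add, hx, hx']
    | smul r x hx => simp only [smul_mul_assoc, map_smul, hx]
    | basis a =>
      induction y using TreeSpace.basis_induction with
      | zero => simp
      | add y y' hy hy' => simp only [mul_add, map_add, hy, hy']
      | smul r y hy => simp only [mul_smul_comm, map_smul, hy]
      | basis τ =>
        rw [TreeSpace.treeBasis_mul, gradingScale_graft, gradingScale_basis, gradingScale_basis,
          smul_mul_smul_comm, TreeSpace.treeBasis_mul, pow_add]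

theorem psi_gradingScale (x : TreeSpace 𝔏) :
    psi 𝔏 (gradingScale (treeBasis 𝔏) DecTree.numNodes x) =
      gradingScale (zBasis 𝔏) (fun β => β.1.degree) (psi 𝔏 x) := by
  induction x using TreeSpace.basis_induction with
  | zero => simp
  | add x y hx hy => simp only [map_add, hx, hy]
  | smul r x hx => simp only [map_smul, hx]
  | basis τ =>
    rw [gradingScale_basis, map_smul, psi_treeBasis, map_smul, gradingScale_basis,
      DecTree.degree_fertility, smul_comm]

end Gradings

/-! ### Projection of the enveloping algebra to its linear part -/

section LinearPart

variable {L : Type*} [LeftPreLieRing L] [LeftPreLieAlgebra ℝ L] {ι : Type*}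
  {M : Type*} [AddCommGroup M] [Module ℝ M]

attribute [local instance 100] LieRing.ofAssociativeRing

open MvPolynomial

open scoped Classical in
theorem goProd_eq_smul_goElem (b : ι → L) (s : Multiset ι) :
    goProd b s = ((Multiset.toFinsupp s).prod fun _ n => (n.factorial : ℝ)) •
      goElem b (Multiset.toFinsupp s) := by
  rw [← goProd_toMultiset, Multiset.toFinsupp_toMultiset]

open scoped Classical in
theorem goPairing_goProd (b : Module.Basis ι ℝ L) (w : ι → ℝ) (s : Multiset ι)
    (p : MvPolynomial ι ℝ) : goPairing b w (goProd b s) p =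
      (∏ i ∈ s.toFinset, ((s.count i).factorial : ℝ)) * (s.map w).prod *
        coeff (Multiset.toFinsupp s) p := by
  rw [goProd_eq_smul_goElem, map_smul, LinearMap.smul_apply, goPairing_goElem, smul_eq_mul,
    ← mul_assoc, Finset.prod_multiset_map_count, Finsupp.prod, Finsupp.prod,
    Multiset.toFinsupp_support]
  simp only [Multiset.toFinsupp_apply]

/-- The linear extension of a function of the Guin–Oudom products. -/
def goConstr (b : Module.Basis ι ℝ L) (f : Multiset ι → M) : Env L →ₗ[ℝ] M :=
  (goBasis b).constr ℝ fun I =>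
    (I.prod fun _ n => (n.factorial : ℝ))⁻¹ • f (Finsupp.toMultiset I)

theorem goConstr_goProd (b : Module.Basis ι ℝ L) (f : Multiset ι → M) (s : Multiset ι) :
    goConstr b f (goProd b s) = f s := by
  classical
  have hne : ((Multiset.toFinsupp s).prod fun _ n => (n.factorial : ℝ)) ≠ 0 :=
    Finset.prod_ne_zero_iff.mpr fun i _ => by positivity
  rw [goProd_eq_smul_goElem, map_smul, ← goBasis_apply, goConstr, Module.Basis.constr_basis,
    smul_smul, mul_inv_cancel₀ hne, one_smul, Multiset.toFinsupp_toMultiset]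

/-- The composition of `n : L → M` with the projection of `U(L)` to `L` along the Guin–Oudom
basis. -/
def linearPart (b : Module.Basis ι ℝ L) (n : L →ₗ[ℝ] M) : Env L →ₗ[ℝ] M :=
  goConstr b fun s => if Multiset.card s = 1 then n (s.map b).sum else 0

variable (b : Module.Basis ι ℝ L) (w : ι → ℝ) (n : L →ₗ[ℝ] M)

theorem linearPart_goProd (s : Multiset ι) : linearPart b n (goProd b s) =
    if Multiset.card s = 1 then n (s.map b).sum else 0 :=
  goConstr_goProd _ _ _

theorem linearPart_one : linearPart b n 1 = 0 := by
  rw [← goProd_zero b, linearPart_goProd]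
  simp

theorem goPairing_goStar_one (u : Env L) (a : L) : goPairing b w (goStar u a) 1 = 0 := by
  rw [goPairing_goStar, Derivation.map_one_eq_zero, map_zero]

/-- A product of `⋆`-length one arises from `u ⋆ a` only through the multiple of `1` in `u`, and
pairing with `1` reads off that multiple. -/
theorem linearPart_goStar (u : Env L) (a : L) :
    linearPart b n (goStar u a) = goPairing b w u 1 • n a := by
  have hbasis : ∀ i, linearPart b n ∘ₗ goStarRight (b i) =
      ((goPairing b w).flip 1).smulRight (n (b i)) := fun i => by
    refine Env.ext_goProd b fun s => ?_
    change linearPart b n (goStar (goProd b s) (b i)) = goPairing b w (goProd b s) 1 • n (b i)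
    rw [← goProd_cons, linearPart_goProd]
    induction s using Multiset.induction with
    | empty => simp [goProd_zero, goPairing_one_one]
    | cons j s _ => rw [goProd_cons, goPairing_goStar_one]; simp
  have h : linearPart b n ∘ₗ goStar u = goPairing b w u 1 • n :=
    b.ext fun i => LinearMap.congr_fun (hbasis i) u
  exact LinearMap.congr_fun h a

/-- The cocycle identity before transposition. In `a (u ⋆ c) = (a u) ⋆ c + u ⋆ (a ▷ c)` the first
term has no linear part, and `hn` converts the second into `a` times the linear part of `u ⋆ c`. -/
theorem linearPart_mul {n : L →ₗ[ℝ] Env L} (hn : ∀ a c, n (a * c) = Env.of a * n c)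
    (u v : Env L) : linearPart b n (u * v) =
      goPairing b w v 1 • linearPart b n u + u * linearPart b n v := by
  have hof : ∀ (a : L) (v : Env L), linearPart b n (Env.of a * v) =
      goPairing b w v 1 • linearPart b n (Env.of a) + Env.of a * linearPart b n v := by
    intro a v
    induction v using Env.induction_goStar b with
    | h1 => rw [mul_one, goPairing_one_one, one_smul, linearPart_one, mul_zero, add_zero]
    | hadd u v hu hv => simp only [mul_add, map_add, LinearMap.add_apply, hu, hv, add_smul]; abel
    | hsmul r u hu =>
      simp only [mul_smul_comm, map_smul, LinearMap.smul_apply, hu, smul_add, smul_assoc]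
    | hstar u i _ =>
      have h : Env.of a * goStar u (b i) = goStar (Env.of a * u) (b i) + goStar u (a * b i) := by
        rw [goStar_of_mul]; abel
      rw [h, map_add, linearPart_goStar b w, linearPart_goStar b w, linearPart_goStar b w,
        goPairing_of_mul_one, goPairing_goStar_one, hn, zero_smul, zero_smul, mul_smul_comm]
  induction u using Env.induction with
  | h1 => rw [one_mul, one_mul, linearPart_one, smul_zero, zero_add]
  | hadd u u' hu hu' => simp only [add_mul, map_add, hu, hu', smul_add]; abel
  | hsmul r u hu => simp only [smul_mul_assoc, map_smul, hu, smul_add, smul_comm r]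
  | hmul a u hu =>
    rw [mul_assoc, hof, hu, hof, goPairing_mul_one, smul_add, mul_add, mul_smul_comm, mul_assoc,
      smul_smul, add_assoc, mul_comm (goPairing b w u 1)]

/-- Left multiplication by `a` either adjoins `a` as a new factor or lets it act on one factor, the
same dichotomy as in the recursion for grafting. -/
theorem of_mul_goProd [DecidableEq ι] (a : L) (s : Multiset ι) : Env.of a * goProd b s =
    goStar (goProd b s) a + (s.map fun t => goStar (goProd b (s.erase t)) (a * b t)).sum := by
  induction s using Multiset.induction with
  | empty => simp [goProd_zero, goStar_one]
  | cons t s ih =>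
    have h : Env.of a * goStar (goProd b s) (b t) =
        goStar (Env.of a * goProd b s) (b t) + goStar (goProd b s) (a * b t) := by
      rw [goStar_of_mul]; abel
    have h' : (s.map fun u => goStar (goProd b ((t ::ₘ s).erase u)) (a * b u)) =
        s.map fun u => goStarRight (b t) (goStar (goProd b (s.erase u)) (a * b u)) :=
      Multiset.map_congr rfl fun u hu => by
        rw [Multiset.erase_cons_tail_of_mem hu, goProd_cons, goStar_comm]
        rfl
    have h'' := map_multiset_sum (goStarRight (b t))
      (s.map fun u => goStar (goProd b (s.erase u)) (a * b u))
    rw [Multiset.map_map] at h''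
    rw [goProd_cons, h, ih, goStar_add, Multiset.map_cons, Multiset.sum_cons,
      Multiset.erase_cons_head, h', goStar_comm]
    change _ + goStarRight (b t) _ + _ = _
    rw [h'']
    simp only [Function.comp_def]
    abel

end LinearPart

/-! ### Identification with the Connes–Kreimer coproduct -/

section ConnesKreimer

attribute [local instance 100] LieRing.ofAssociativeRing

open MvPolynomial

variable {𝔏 : Type*}

theorem DecTree.symFactor_ne_zero (τ : DecTree 𝔏) : τ.symFactor ≠ 0 := by
  classical
  induction τ using DecTree.ind with
  | h l m ih =>
    rw [symFactor_node]
    refine mul_ne_zero (Finset.prod_ne_zero_iff.mpr fun t _ => Nat.factorial_ne_zero _) ?_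
    refine Multiset.prod_ne_zero fun h => ?_
    obtain ⟨t, ht, h0⟩ := Multiset.mem_map.mp h
    exact ih t ht h0

open scoped Classical in
/-- The forest `τ_1 ⋆ ⋯ ⋆ τ_k` obtained by cutting off the root of `Ξ_l ∏ ℐ(τ_j)`, and zero if the
root is not decorated by `l`. -/
def cutRoot (l : 𝔏) : TreeSpace 𝔏 →ₗ[ℝ] Env (TreeSpace 𝔏) :=
  (treeBasis 𝔏).constr ℝ fun τ => if τ.root = l then goProd (treeBasis 𝔏) τ.children else 0

open scoped Classical in
theorem cutRoot_node (l l' : 𝔏) (m : Multiset (DecTree 𝔏)) :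
    cutRoot l (treeBasis 𝔏 (DecTree.node l' m)) =
      if l' = l then goProd (treeBasis 𝔏) m else 0 := by
  rw [cutRoot, Module.Basis.constr_basis, DecTree.root_node, DecTree.children_node]

open scoped Classical in
theorem cutRoot_attachTo (l l' : 𝔏) (m : Multiset (DecTree 𝔏)) (x : TreeSpace 𝔏) :
    cutRoot l (TreeSpace.attachTo l' m x) =
      if l' = l then goStar (goProd (treeBasis 𝔏) m) x else 0 := by
  induction x using TreeSpace.basis_induction with
  | zero => simp
  | add x y hx hy => simp only [map_add, hx, hy]; split_ifs <;> simp
  | smul r x hx => simp only [map_smul, hx]; split_ifs <;> simp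
  | basis τ => rw [TreeSpace.attachTo, Module.Basis.constr_basis, cutRoot_node, goProd_cons]

/-- Grafting at the root adds a tree to the forest below it and grafting higher up acts on one of
its trees; by `of_mul_goProd` this is left multiplication. It supplies the hypothesis of
`linearPart_mul`. -/
theorem cutRoot_mul (l : 𝔏) (x y : TreeSpace 𝔏) :
    cutRoot l (x * y) = Env.of x * cutRoot l y := by
  classical
  induction x using TreeSpace.basis_induction with
  | zero => simp
  | add x x' hx hx' => simp only [add_mul, map_add, hx, hx']
  | smul r x hx => simp only [smul_mul_assoc, map_smul, hx]
  | basis a =>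
    induction y using TreeSpace.basis_induction with
    | zero => simp
    | add y y' hy hy' => simp only [mul_add, map_add, hy, hy']
    | smul r y hy => simp only [mul_smul_comm, map_smul, hy]
    | basis τ =>
      rw [← DecTree.node_root_children τ]
      generalize τ.root = l'
      generalize τ.children = m
      rw [TreeSpace.treeBasis_mul, DecTree.graft_node, map_add, map_multiset_sum,
        Multiset.map_map, cutRoot_node, cutRoot_node]
      simp only [Function.comp_def, cutRoot_attachTo]
      split_ifs with h
      · rw [of_mul_goProd, goProd_cons]
        simp only [TreeSpace.treeBasis_mul]
      · simp

theorem bPlus_monomial (l : 𝔏) (J : DecTree 𝔏 →₀ ℕ) :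
    bPlus l (monomial J 1) = X (DecTree.node l (Finsupp.toMultiset J)) := by
  have h : monomial J (1 : ℝ) = basisMonomials (DecTree 𝔏) ℝ J := by rw [coe_basisMonomials]
  rw [h, bPlus, Module.Basis.constr_basis]

theorem bPlus_prod (l : 𝔏) (m : Multiset (DecTree 𝔏)) :
    bPlus l (m.map (X (R := ℝ))).prod = X (DecTree.node l m) := by
  classical
  have h : ∀ m : Multiset (DecTree 𝔏),
      (m.map (X (R := ℝ))).prod = monomial (Multiset.toFinsupp m) 1 := fun m => by
    induction m using Multiset.induction with
    | empty => simp
    | cons t m ih =>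
      rw [Multiset.map_cons, Multiset.prod_cons, ih, ← Multiset.singleton_add, map_add,
        Multiset.toFinsupp_singleton, X, monomial_mul, one_mul]
  rw [h, bPlus_monomial, Multiset.toFinsupp_toMultiset]

/-- Cutting the root is adjoint to `B₊`. -/
theorem treePairing_bPlus (l : 𝔏) (u : Env (TreeSpace 𝔏)) (p : MvPolynomial (DecTree 𝔏) ℝ) :
    treePairing 𝔏 u (bPlus l p) =
      treePairing 𝔏 (linearPart (treeBasis 𝔏) (cutRoot l) u) p := by
  classical
  have h : (treePairing 𝔏).compl₂ (bPlus l) =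
      treePairing 𝔏 ∘ₗ linearPart (treeBasis 𝔏) (cutRoot l) := by
    refine Env.ext_goProd (treeBasis 𝔏) fun s => (basisMonomials (DecTree 𝔏) ℝ).ext fun J => ?_
    rw [coe_basisMonomials, LinearMap.compl₂_apply, LinearMap.comp_apply, bPlus_monomial,
      linearPart_goProd, treePairing, goPairing_goProd, X, coeff_monomial]
    by_cases hs : Multiset.card s = 1
    · obtain ⟨τ, rfl⟩ := Multiset.card_eq_one.mp hs
      rw [if_pos hs, Multiset.map_singleton, Multiset.map_singleton, Multiset.sum_singleton,
        Multiset.toFinsupp_singleton, ← DecTree.node_root_children τ]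
      generalize τ.root = l'
      generalize τ.children = m
      rw [cutRoot_node]
      by_cases hJ : DecTree.node l (Finsupp.toMultiset J) = DecTree.node l' m
      · have hl : l = l' := by simpa using congrArg DecTree.root hJ
        have hm : Finsupp.toMultiset J = m := by simpa using congrArg DecTree.children hJ
        subst hl hm
        -- The forest pairs with itself to `I! ∏ σ(τ_j)`, which is the symmetry factor of the tree:
        -- the weights of the pairing are chosen for this match.
        rw [if_pos rfl, if_pos rfl, goPairing_goProd, Finsupp.toMultiset_toFinsupp, coeff_monomial,
          if_pos rfl, DecTree.symFactor_node]
        simp [Multiset.map_map]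
      · rw [if_neg fun h => hJ (Finsupp.single_left_injective one_ne_zero h), mul_zero]
        split_ifs with hl
        · rw [goPairing_goProd, coeff_monomial, if_neg, mul_zero]
          rintro rfl
          exact hJ (by rw [Multiset.toFinsupp_toMultiset, hl])
        · simp
    · rw [if_neg hs, map_zero, LinearMap.zero_apply, if_neg, mul_zero]
      intro h
      apply hs
      have := congrArg Finsupp.toMultiset h
      rw [Multiset.toFinsupp_toMultiset, Finsupp.toMultiset_single, one_smul] at this
      rw [← this, Multiset.card_singleton]
  exact LinearMap.congr_fun (LinearMap.congr_fun h u) p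

variable {Δ : MvPolynomial (DecTree 𝔏) ℝ →ₗ[ℝ]
    MvPolynomial (DecTree 𝔏) ℝ ⊗[ℝ] MvPolynomial (DecTree 𝔏) ℝ}
  (hΔ : IsDualComul (treeBasis 𝔏) (fun τ => (τ.symFactor : ℝ)) Δ)
include hΔ

/-- The operators `B₊` are Hochschild cocycles. -/
theorem IsDualComul.comul_bPlus (l : 𝔏) (p : MvPolynomial (DecTree 𝔏) ℝ) :
    Δ (bPlus l p) = bPlus l p ⊗ₜ 1 + (bPlus l).lTensor _ (Δ p) := by
  have hw : ∀ τ : DecTree 𝔏, (τ.symFactor : ℝ) ≠ 0 := fun τ =>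
    Nat.cast_ne_zero.mpr τ.symFactor_ne_zero
  refine leftSlice_ext (treeBasis 𝔏) hw fun u => goPairing_ext (treeBasis 𝔏) hw fun v => ?_
  have hB := treePairing_bPlus l (𝔏 := 𝔏)
  simp only [treePairing] at hB
  -- Tested on `u ⊗ v`, the identity becomes `linearPart_mul` paired with `p`.
  rw [hΔ, map_add, map_add, leftSlice_tmul, map_smul, leftSlice_lTensor, hB, hB, hB, hΔ,
    linearPart_mul (treeBasis 𝔏) (fun τ => (τ.symFactor : ℝ)) (cutRoot_mul l), map_add,
    LinearMap.add_apply, map_smul, LinearMap.smul_apply, smul_eq_mul, smul_eq_mul, mul_comm]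

/-- Both sides are algebra morphisms, so it suffices to compare them on trees; there the cocycle
identity, applied to the forest of subtrees, is the defining recursion. -/
theorem IsDualComul.comulHom_eq_ckComul (hw : ∀ τ : DecTree 𝔏, (τ.symFactor : ℝ) ≠ 0) :
    hΔ.comulHom hw = ckComul 𝔏 := by
  refine algHom_ext fun τ => ?_
  rw [ckComul, aeval_X]
  induction τ using DecTree.ind with
  | h l m ih =>
    have h : hΔ.comulHom hw (m.map X).prod = (m.map ckTree).prod := by
      rw [map_multiset_prod, Multiset.map_map]
      exact congrArg _ (Multiset.map_congr rfl ih)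
    rw [ckTree_node, ← h, ← bPlus_prod]
    exact hΔ.comul_bPlus l _

end ConnesKreimer

end

theorem mainTheorem4 (𝔏 : Type*) [Finite 𝔏] :
    -- `Ψ` is a pre-Lie morphism from the grafting product to `(T, D)`
    (∀ x y : TreeSpace 𝔏, psi 𝔏 (x * y) = psi 𝔏 x * psi 𝔏 y) ∧
    -- its lift to an algebra morphism of the enveloping algebras
    ∃ Ψhat : Env (TreeSpace 𝔏) →ₐ[ℝ] Env (MultiIndexSpace 𝔏),
      (∀ x : TreeSpace 𝔏, Ψhat (Env.of x) = Env.of (psi 𝔏 x)) ∧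
    -- the Hopf algebra `(ℝ[𝒯], Δ_D)` and the Connes–Kreimer Hopf algebra
    ∃ (H : HopfStructure (MvPolynomial (Populated 𝔏) ℝ))
      (CK : HopfStructure (MvPolynomial (DecTree 𝔏) ℝ)),
      IsTransposeOfMul (multiIndexPairing 𝔏) H.comul ∧
      CK.comul = ckComul 𝔏 ∧
    -- the transpose `Ψ†` of `Ψhat` exists and is a Hopf algebra morphism
    ∃ Ψdagger : MvPolynomial (Populated 𝔏) ℝ →ₐ[ℝ] MvPolynomial (DecTree 𝔏) ℝ,
      (∀ (u : Env (TreeSpace 𝔏)) (p : MvPolynomial (Populated 𝔏) ℝ),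
        treePairing 𝔏 u (Ψdagger p) = multiIndexPairing 𝔏 (Ψhat u) p) ∧
      H.IsHom CK Ψdagger := by

  have hw : ∀ τ : DecTree 𝔏, (τ.symFactor : ℝ) ≠ 0 := fun τ =>
    Nat.cast_ne_zero.mpr τ.symFactor_ne_zero
  have hw' : ∀ _ : Populated 𝔏, (1 : ℝ) ≠ 0 := fun _ => one_ne_zero
  have hd := isPreLieGrading_treeBasis (𝔏 := 𝔏)
  have hd' := isPreLieGrading_zBasis (𝔏 := 𝔏)
  obtain ⟨Δ, hΔ⟩ := hd.exists_isDualComul hw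
  obtain ⟨Δ', hΔ'⟩ := hd'.exists_isDualComul hw'
  obtain ⟨S, hS⟩ := hd.exists_antipode hw
  obtain ⟨S', hS'⟩ := hd'.exists_antipode hw'
  -- The lift of `Ψ` commutes with the scalings because it does so on generators, by
  -- `psi_gradingScale`.
  obtain ⟨T, hT⟩ := hd.exists_adjoint hw hd' (fun _ => 1) (Env.map (psi 𝔏) psi_mul).toLinearMap
    fun u => by
      induction u using Env.induction with
      | h1 => simp
      | hadd u v hu hv => simp only [map_add, hu, hv]
      | hsmul r u hu => simp only [map_smul, hu]
      | hmul a u hu =>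
        simp only [AlgHom.toLinearMap_apply, IsPreLieGrading.scale, Env.map_of_mul] at hu ⊢
        rw [hu, psi_gradingScale]
  exact ⟨psi_mul, Env.map (psi 𝔏) psi_mul, Env.map_of psi_mul, hΔ'.hopfStructure hw' hS',
    hΔ.hopfStructure hw hS, hΔ'.isTransposeOfMul_hopfStructure hw' hS',
    hΔ.comulHom_eq_ckComul hw, transposeHom hΔ hΔ' hw hw' psi_mul hT, hT,
    isHom_transposeHom hΔ hΔ' hw hw' psi_mul hT hS hS'⟩
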